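/- Let $\mathbb D$ be the open unit disk and $\mathbb T$ its boundary circle. Let $H^2$ be the Hardy space of analytic functions $f$ in $\mathbb D$ for which $\frac1{2\pi}\int_0^{2\pi}|f(re^{i\theta})|^2\,d\theta$ is bounded for $0\le r<1$, and write $f(e^{i\theta})=\lim_{r\to1^-}f(re^{i\theta})$ for the boundary values (which exist for almost every $\theta$) and $\|f\|_2=\left(\frac1{2\pi}\int_0^{2\pi}|f(e^{i\theta})|^2\,d\theta\right)^{1/2}$. For an integer $k\ge1$ let $H^{k,2}=\{f\in H^2: f^{(j)}\in H^2,\ j=1,\dots,k\}$ with the norm $\|f\|_{k,2}=\left(\sum_{j=0}^k\|f^{(j)}\|_2^2\right)^{1/2}$. For a subarc $I$ of $\mathbb T$ of length $2\pi\lambda$, $\lambda\in(0,1)$, let $\|f\|_{2,I}=\left(\frac1{2\pi\lambda}\int_I|f(e^{i\theta})|^2\,d\theta\right)^{1/2}$. For every integer $k\ge1$ there exist positive constants $\alpha_k$ and $\gamma_k$, depending only on $k$, such that for every $\lambda\in(0,1)$, every subarc $I$ of $\mathbb T$ of length $2\pi\lambda$, and every $f\in H^{k,2}$ with $\|f\|_{k,2}\le1$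 and $\|f\|_{2,I}\le e^{-\gamma_k/\lambda}$, we have $$\|f\|_2\le\frac{\alpha_k}{\left(\lambda\log(1/\|f\|_{2,I})\right)^k},$$ where the right-hand side is read as $0$ if $\|f\|_{2,I}=0$. -/

import Mathlib

open Filter Topology

noncomputable section

namespace HardySobolev

/-- The integral mean `M_f(r) = ((1/2π) ∫₀^{2π} |f(r e^{iθ})|² dθ)^{1/2}`. -/
def integralMean (f : ℂ → ℂ) (r : ℝ) : ℝ :=
  Real.sqrt ((2 * Real.pi)⁻¹ *
    ∫ θ in (0 : ℝ)..(2 * Real.pi), ‖f ((r : ℂ) * Complex.exp ((θ : ℂ) * Complex.I))‖ ^ 2)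

/-- The Hardy space `H²` of the unit disk: `f` is analytic in the open unit disk and its `L²` means
on the circles of radius `r < 1` are bounded. The values of `f` off the disk are irrelevant. -/
def MemH2 (f : ℂ → ℂ) : Prop :=
  DifferentiableOn ℂ f (Metric.ball 0 1) ∧
    ∃ C : ℝ, ∀ r ∈ Set.Ico (0 : ℝ) 1, integralMean f r ≤ C

/-- The boundary value `f(e^{iθ}) = lim_{r → 1⁻} f(r e^{iθ})`, the radial limit. For `f ∈ H²` it
exists for almost every `θ`. -/
def boundaryValue (f : ℂ → ℂ) (θ : ℝ) : ℂ :=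
  limUnder (𝓝[<] (1 : ℝ)) (fun r : ℝ => f ((r : ℂ) * Complex.exp ((θ : ℂ) * Complex.I)))

/-- `‖f‖₂ = ((1/2π) ∫₀^{2π} |f(e^{iθ})|² dθ)^{1/2}`. -/
def norm2 (f : ℂ → ℂ) : ℝ :=
  Real.sqrt ((2 * Real.pi)⁻¹ * ∫ θ in (0 : ℝ)..(2 * Real.pi), ‖boundaryValue f θ‖ ^ 2)

/-- `‖f‖_{2,I} = ((1/(2πlam)) ∫_I |f(e^{iθ})|² dθ)^{1/2}`, where `I` is the arc
`{e^{iθ} : a ≤ θ ≤ a + 2πlam}` of length `2πlam`. -/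
def normArc (f : ℂ → ℂ) (a lam : ℝ) : ℝ :=
  Real.sqrt ((2 * Real.pi * lam)⁻¹ *
    ∫ θ in a..(a + 2 * Real.pi * lam), ‖boundaryValue f θ‖ ^ 2)

/-- The Hardy–Sobolev space `H^{k,2}`: `f` and its complex derivatives `f^{(j)}`, `1 ≤ j ≤ k`, lie
in `H²`. -/
def MemHk2 (k : ℕ) (f : ℂ → ℂ) : Prop :=
  ∀ j ≤ k, MemH2 (iteratedDeriv j f)

/-- `‖f‖_{k,2} = (∑_{j=0}^k ‖f^{(j)}‖₂²)^{1/2}`. -/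
def normk2 (k : ℕ) (f : ℂ → ℂ) : ℝ :=
  Real.sqrt (∑ j ∈ Finset.range (k + 1), norm2 (iteratedDeriv j f) ^ 2)

/-- The unit ball `B_{k,2}` of `H^{k,2}`. -/
def unitBall (k : ℕ) : Set (ℂ → ℂ) :=
  {f | MemHk2 k f ∧ normk2 k f ≤ 1}

end HardySobolev

end

/-!
# Logarithmic stability of `H^{k,2}` functions that are small on an arc

Write `a n` for the Taylor coefficients of `f`, `s = ‖f‖₂`, `ε = ‖f‖_{2,I}`, `N = λ log (1/ε)`.

The heart is a two-constants estimate with the right dependence on `s`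
(`tsum_mul_pow_le_of_arc`). Let `h` be analytic in the disk with `Re h` the harmonic measure of the
arc `I` (the Herglotz integral of its indicator), and put `g = f exp (τ h)` with `τ = log (s/ε)`. On
the circle `|g|` is `|f| s/ε` on `I` and `|f|` off `I`, so `‖g‖₂² ≤ 2 s²`. The `L²` means of `g` on
circles increase with the radius, and on `|z| = r` Harnack's inequality gives
`Re h ≥ λ (1 - r)/(1 + r)`. Hence
`∑ |a n|² r^{2n} ≤ 2 s² (ε/s)^{2λ(1 - r)/(1 + r)}`.

The factor `s²` on the right makes an absorption argument possible. If `s² ≤ ε` there is nothing to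
do. Otherwise `ε/s ≤ √ε`, and `1 - r = 8/N` makes the right side at most `2 e^{-4} s²`. On the other hand
`r^{2n} ≥ e^{-2}` for all `n` up to `N/16`, so these frequencies carry at most half of `s²`. The
others carry at most `O(N^{-2k})` because `f^{(k)}` has norm at most one
(`tsum_le_of_tail_of_damped`). Thus `s² = O(N^{-2k})`.

The norms are defined by radial limits, so translating the hypothesis on `f^{(k)}`, which is merely
an `H²` function, into a bound for its Taylor coefficients needs Fatou's theorem on the almost
everywhere existence of these limits (`exists_radial_limit`): the function is the Poisson integral
of its `L²` boundary function, and Poisson integrals converge at Lebesgue points. For `f` itself the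
coefficients are absolutely summable, and the limits exist everywhere.
-/

namespace HardySobolev

open MeasureTheory Complex

/-! ### One-sided Fourier series in `L²` of the circle -/

/-- Lets Mathlib's Fourier theory on `AddCircle T` be used with `T = 2π`. -/
instance fact_two_pi_pos : Fact (0 < 2 * Real.pi) := ⟨Real.two_pi_pos⟩

theorem fourier_two_pi_coe (n : ℕ) (θ : ℝ) :
    fourier (T := 2 * Real.pi) (n : ℤ) (θ : AddCircle (2 * Real.pi)) = exp (θ * I) ^ n := by
  have hpi : (Real.pi : ℂ) ≠ 0 := by exact_mod_cast Real.pi_ne_zero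
  rw [fourier_coe_apply, ← Complex.exp_nat_mul]
  congr 1
  push_cast
  field_simp

/-- The Riesz–Fischer theorem for series with nonnegative frequencies. -/
theorem exists_hasSum_fourierLp {c : ℕ → ℂ} (hc : Summable fun n => ‖c n‖ ^ 2) :
    ∃ F : Lp ℂ 2 (AddCircle.haarAddCircle (T := 2 * Real.pi)),
      HasSum (fun n : ℕ => c n • fourierLp (T := 2 * Real.pi) 2 (n : ℤ)) F ∧
      ‖F‖ ^ 2 = ∑' n, ‖c n‖ ^ 2 := by
  set d : ℤ → ℂ := Function.extend (Nat.cast : ℕ → ℤ) c 0 with hd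
  have hinj : Function.Injective (Nat.cast : ℕ → ℤ) := Nat.cast_injective
  have hdc : ∀ n : ℕ, d n = c n := fun n => hinj.extend_apply c 0 n
  have hd0 : ∀ i : ℤ, i ∉ Set.range (Nat.cast : ℕ → ℤ) → d i = 0 := fun i hi => by
    rw [hd, Function.extend_apply' _ _ _ hi]; rfl
  have hS : HasSum (fun i => ‖d i‖ ^ 2) (∑' n, ‖c n‖ ^ 2) := by
    rw [← hinj.hasSum_iff (fun i hi => by simp [hd0 i hi])]
    simpa [Function.comp_def, hdc] using hc.hasSum
  have hmem : Memℓp d 2 := by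
    rw [memℓp_gen_iff (by norm_num)]
    simpa using hS.summable
  let D : lp (fun _ : ℤ => ℂ) 2 := ⟨d, hmem⟩
  refine ⟨(fourierBasis (T := 2 * Real.pi)).repr.symm D, ?_, ?_⟩
  · have h := (fourierBasis (T := 2 * Real.pi)).hasSum_repr_symm D
    rw [← hinj.hasSum_iff (fun i hi => by simp [D, hd0 i hi])] at h
    simpa [Function.comp_def, D, hdc] using h
  · rw [LinearIsometryEquiv.norm_map]
    have h := lp.hasSum_norm (p := 2) (by norm_num) D
    simp only [ENNReal.toReal_ofNat, Real.rpow_ofNat] at h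
    exact h.unique hS

theorem norm_sq_lp_eq_intervalIntegral
    (F : Lp ℂ 2 (AddCircle.haarAddCircle (T := 2 * Real.pi))) :
    ‖F‖ ^ 2 = (2 * Real.pi)⁻¹ *
      ∫ θ in (0 : ℝ)..(2 * Real.pi), ‖F (θ : AddCircle (2 * Real.pi))‖ ^ 2 := by
  have H₃ := congr_arg RCLike.re (@L2.inner_def (AddCircle (2 * Real.pi)) ℂ ℂ _ _ _ _ _ F F)
  rw [← integral_re (L2.integrable_inner F F)] at H₃
  simp only [← norm_sq_eq_re_inner] at H₃
  rw [H₃, AddCircle.integral_haarAddCircle, smul_eq_mul]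
  congr 1
  have := AddCircle.intervalIntegral_preimage (2 * Real.pi) 0 (fun x => ‖F x‖ ^ 2)
  rw [zero_add] at this
  exact this.symm

theorem ae_coe_of_ae_haarAddCircle {p : AddCircle (2 * Real.pi) → Prop}
    (h : ∀ᵐ x ∂(AddCircle.haarAddCircle (T := 2 * Real.pi)), p x) (a : ℝ) :
    ∀ᵐ θ : ℝ ∂(volume.restrict (Set.Ioc a (a + 2 * Real.pi))), p (θ : AddCircle (2 * Real.pi)) := by
  have h' : ∀ᵐ x ∂(volume : Measure (AddCircle (2 * Real.pi))), p x := by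
    rw [AddCircle.volume_eq_smul_haarAddCircle]
    exact Measure.ae_smul_measure h _
  exact (AddCircle.measurePreserving_mk (2 * Real.pi) a).quasiMeasurePreserving.ae h'

/-- **Parseval's identity** for an absolutely convergent one-sided trigonometric series. -/
theorem parseval_of_summable {c : ℕ → ℂ} (hc : Summable fun n => ‖c n‖) :
    (2 * Real.pi)⁻¹ * ∫ θ in (0 : ℝ)..(2 * Real.pi), ‖∑' n, c n * exp (θ * I) ^ n‖ ^ 2
      = ∑' n, ‖c n‖ ^ 2 := by
  have hc2 : Summable fun n => ‖c n‖ ^ 2 := by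
    have h := hc.tendsto_atTop_zero.eventually_le_const one_pos
    refine Summable.of_norm_bounded_eventually_nat hc ?_
    filter_upwards [h] with n hn
    rw [norm_pow, norm_norm, sq]
    exact mul_le_of_le_one_left (norm_nonneg _) hn
  -- the uniform limit of the series represents its `L²` limit
  obtain ⟨F, hF, hn⟩ := exists_hasSum_fourierLp hc2
  rw [← hn, norm_sq_lp_eq_intervalIntegral]
  have hsum : Summable fun n : ℕ => c n • fourier (T := 2 * Real.pi) (n : ℤ) := by
    refine Summable.of_norm ?_
    simpa [norm_smul, fourier_norm] using hc
  have h1 := (ContinuousMap.toLp (E := ℂ) 2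
    (AddCircle.haarAddCircle (T := 2 * Real.pi)) ℂ).hasSum hsum.hasSum
  have h2 : F = ContinuousMap.toLp (E := ℂ) 2 (AddCircle.haarAddCircle (T := 2 * Real.pi)) ℂ
      (∑' n : ℕ, c n • fourier (T := 2 * Real.pi) (n : ℤ)) := by
    refine hF.unique ?_
    simpa [Function.comp_def, fourierLp] using h1
  have h3 : ∀ᵐ x ∂(AddCircle.haarAddCircle (T := 2 * Real.pi)),
      F x = (∑' n : ℕ, c n • fourier (T := 2 * Real.pi) (n : ℤ)) x := by
    rw [h2]; exact ContinuousMap.coeFn_toLp _ _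
  have h4 := ae_coe_of_ae_haarAddCircle h3 0
  rw [zero_add] at h4
  congr 1
  refine intervalIntegral.integral_congr_ae ?_
  rw [Set.uIoc_of_le Real.two_pi_pos.le]
  filter_upwards [(ae_restrict_iff' measurableSet_Ioc).1 h4] with θ h hθ
  rw [h hθ]
  have h5 := (ContinuousMap.evalCLM ℂ (θ : AddCircle (2 * Real.pi))).hasSum hsum.hasSum
  have h6 : (∑' n : ℕ, c n • fourier (T := 2 * Real.pi) (n : ℤ)) (θ : AddCircle (2 * Real.pi))
      = ∑' n, c n * exp (θ * I) ^ n := by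
    rw [← ContinuousMap.evalCLM_apply ℂ, ← h5.tsum_eq]
    simp only [ContinuousMap.evalCLM_apply, ContinuousMap.smul_apply,
      fourier_two_pi_coe, smul_eq_mul]
  rw [h6]

/-! ### The Poisson kernel as an approximate identity -/

/-- The denominator `|1 - r e^{it}|²` of the Poisson kernel. -/
noncomputable def poissonDenom (r t : ℝ) : ℝ := 1 - 2 * r * Real.cos t + r ^ 2

/-- The Poisson kernel of the disk at the point `r`, in the angular variable. -/
noncomputable def radialPoisson (r t : ℝ) : ℝ := (1 - r ^ 2) / poissonDenom r t

theorem poissonDenom_pos {r : ℝ} (h0 : 0 < r) (h1 : r < 1) (t : ℝ) : 0 < poissonDenom r t := by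
  have := Real.cos_le_one t
  have h2 : 0 < (1 - r) ^ 2 := by have : 0 < 1 - r := by linarith
                                  positivity
  unfold poissonDenom
  nlinarith

theorem le_poissonDenom {r t : ℝ} (h0 : 1 / 2 < r) (ht : |t| ≤ Real.pi) :
    2 / Real.pi ^ 2 * t ^ 2 ≤ poissonDenom r t := by
  have h := Real.cos_le_one_sub_mul_cos_sq ht
  have hpi := Real.pi_pos
  have : 0 ≤ 2 / Real.pi ^ 2 * t ^ 2 := by positivity
  unfold poissonDenom
  nlinarith [sq_nonneg (1 - r)]

theorem hasDerivAt_radialPoisson {r : ℝ} (h0 : 0 < r) (h1 : r < 1) (t : ℝ) :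
    HasDerivAt (radialPoisson r)
      (-((1 - r ^ 2) * (2 * r * Real.sin t)) / poissonDenom r t ^ 2) t := by
  have hD : HasDerivAt (poissonDenom r) (2 * r * Real.sin t) t := by
    have := (((Real.hasDerivAt_cos t).const_mul (2 * r)).const_sub 1).add_const (r ^ 2)
    exact this.congr_deriv (by ring)
  have := (hasDerivAt_const t (1 - r ^ 2)).div hD (poissonDenom_pos h0 h1 t).ne'
  exact this.congr_deriv (by ring)

theorem radialPoisson_eq_poissonKernel (r t : ℝ) :
    radialPoisson r t = poissonKernel 0 (r : ℂ) (exp (t * I)) := by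
  have h : ‖exp (t * I) - (r : ℂ)‖ ^ 2 = poissonDenom r t := by
    rw [← normSq_eq_norm_sq, normSq_apply]
    simp only [sub_re, sub_im, exp_ofReal_mul_I_re, exp_ofReal_mul_I_im, ofReal_re, ofReal_im,
      poissonDenom]
    nlinarith [Real.sin_sq_add_cos_sq t]
  rw [poissonKernel_def, sub_zero, sub_zero, h, norm_exp_ofReal_mul_I]
  simp [radialPoisson]

/-- The Poisson kernel has total mass one: the Poisson formula for the constant `1`. -/
theorem circleAverage_poissonKernel {w : ℂ} (hw : ‖w‖ < 1) :
    (2 * Real.pi)⁻¹ * ∫ θ in (0 : ℝ)..(2 * Real.pi), poissonKernel 0 w (exp (θ * I)) = 1 := by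
  have h := (diffContOnCl_const (c := (1 : ℂ)) (s := Metric.ball (0 : ℂ) 1)
    (𝕜 := ℂ)).circleAverage_poissonKernel_smul (w := w) (by simpa using hw)
  simp only [Real.circleAverage_def, circleMap, ofReal_one, one_mul, zero_add, Pi.smul_apply',
    real_smul, mul_one] at h
  rw [intervalIntegral.integral_ofReal] at h
  exact_mod_cast h

theorem integral_radialPoisson {r : ℝ} (h0 : 0 < r) (h1 : r < 1) :
    ∫ t in (-Real.pi)..Real.pi, radialPoisson r t = 2 * Real.pi := by
  have h := circleAverage_poissonKernel (w := (r : ℂ)) (by simpa [abs_of_pos h0] using h1)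
  have hper : Function.Periodic (radialPoisson r) (2 * Real.pi) := fun t => by
    simp [radialPoisson, poissonDenom]
  have h2 := hper.intervalIntegral_add_eq (-Real.pi) 0
  rw [zero_add, show -Real.pi + 2 * Real.pi = Real.pi by ring] at h2
  simp_rw [← radialPoisson_eq_poissonKernel] at h
  rw [h2]
  field_simp at h
  linarith

theorem continuous_radialPoisson {r : ℝ} (h0 : 0 < r) (h1 : r < 1) :
    Continuous (radialPoisson r) :=
  continuous_iff_continuousAt.2 fun t => (hasDerivAt_radialPoisson h0 h1 t).continuousAt

theorem continuous_deriv_radialPoisson {r : ℝ} (h0 : 0 < r) (h1 : r < 1) :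
    Continuous (deriv (radialPoisson r)) := by
  have : deriv (radialPoisson r) =
      fun t => -((1 - r ^ 2) * (2 * r * Real.sin t)) / poissonDenom r t ^ 2 :=
    funext fun t => (hasDerivAt_radialPoisson h0 h1 t).deriv
  rw [this]
  refine Continuous.div (by fun_prop) ?_ fun t => (pow_pos (poissonDenom_pos h0 h1 t) 2).ne'
  unfold poissonDenom
  fun_prop

/-- The Poisson kernel decreases away from `0`. -/
theorem mul_deriv_radialPoisson_nonpos {r t : ℝ} (h0 : 0 < r) (h1 : r < 1) (ht : |t| ≤ Real.pi) :
    t * deriv (radialPoisson r) t ≤ 0 := by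
  rw [(hasDerivAt_radialPoisson h0 h1 t).deriv, mul_div_assoc', neg_eq_neg_one_mul]
  refine div_nonpos_of_nonpos_of_nonneg ?_ (sq_nonneg _)
  have hs : 0 ≤ t * Real.sin t := by
    rcases le_total 0 t with h | h
    · exact mul_nonneg h (Real.sin_nonneg_of_nonneg_of_le_pi h ((le_abs_self t).trans ht))
    · exact mul_nonneg_of_nonpos_of_nonpos h
        (Real.sin_nonpos_of_nonpos_of_neg_pi_le h (by linarith [neg_abs_le t]))
  have hr : 0 ≤ (1 - r ^ 2) * (2 * r) := mul_nonneg (by nlinarith) (by linarith)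
  nlinarith [mul_nonneg hr hs]

/-- By monotonicity of the kernel on each side of `0`, this bounds `∫ |t| |P'(t)| dt` by `2π`
uniformly in `r`. -/
theorem integral_mul_deriv_radialPoisson {r : ℝ} (h0 : 0 < r) (h1 : r < 1) :
    -2 * Real.pi ≤ ∫ t in (-Real.pi)..Real.pi, t * deriv (radialPoisson r) t := by
  have h := intervalIntegral.integral_mul_deriv_eq_deriv_mul (a := -Real.pi) (b := Real.pi)
    (u := fun t => t) (u' := fun _ => 1) (v := radialPoisson r) (v' := deriv (radialPoisson r))
    (fun t _ => hasDerivAt_id' t)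
    (fun t _ => (hasDerivAt_radialPoisson h0 h1 t).differentiableAt.hasDerivAt)
    (by simp) ((continuous_deriv_radialPoisson h0 h1).intervalIntegrable _ _)
  simp only [one_mul] at h
  rw [h, integral_radialPoisson h0 h1]
  have : ∀ t, 0 ≤ radialPoisson r t := fun t =>
    div_nonneg (by nlinarith) (poissonDenom_pos h0 h1 t).le
  nlinarith [this Real.pi, this (-Real.pi), Real.pi_pos]

/-- The derivative of the Poisson kernel tends to zero away from `0`. The weight `t ^ 4` absorbs the
singularity at `0`, which makes the bound uniform on the whole period. -/
theorem pow_four_mul_abs_deriv_radialPoisson_le {r t : ℝ} (h0 : 1 / 2 < r) (h1 : r < 1)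
    (ht : |t| ≤ Real.pi) :
    t ^ 4 * |deriv (radialPoisson r) t| ≤ Real.pi ^ 4 / 2 * (1 - r ^ 2) := by
  have hr0 : 0 < r := by linarith
  have hD := poissonDenom_pos hr0 h1 t
  have hpi := Real.pi_pos
  have h2 : t ^ 4 ≤ Real.pi ^ 4 / 4 * poissonDenom r t ^ 2 := by
    have h3 : t ^ 2 ≤ Real.pi ^ 2 / 2 * poissonDenom r t := by
      have := le_poissonDenom h0 ht
      field_simp at this
      linarith
    calc t ^ 4 = (t ^ 2) ^ 2 := by ring
      _ ≤ (Real.pi ^ 2 / 2 * poissonDenom r t) ^ 2 := by gcongr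
      _ = _ := by ring
  have hs : |2 * r * Real.sin t| ≤ 2 := by
    rw [abs_mul, abs_of_pos (by linarith : 0 < 2 * r)]
    nlinarith [Real.abs_sin_le_one t, abs_nonneg (Real.sin t)]
  have hr : 0 ≤ 1 - r ^ 2 := by nlinarith
  rw [(hasDerivAt_radialPoisson hr0 h1 t).deriv, abs_div, abs_neg, abs_mul, abs_of_nonneg hr,
    abs_of_pos (pow_pos hD 2), mul_div_assoc', div_le_iff₀ (pow_pos hD 2)]
  calc t ^ 4 * ((1 - r ^ 2) * |2 * r * Real.sin t|)
      ≤ (Real.pi ^ 4 / 4 * poissonDenom r t ^ 2) * ((1 - r ^ 2) * 2) := by gcongr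
    _ = _ := by ring

/-- The Poisson integral of `φ` tends to zero along the radius to `0` if the primitive of `φ` has
derivative zero there. The proof moves the derivative to the kernel and uses the bounds for its
moments above. -/
theorem tendsto_integral_mul_radialPoisson_zero {φ : ℝ → ℝ}
    (hφ : IntervalIntegrable φ volume (-Real.pi) Real.pi)
    (hd : HasDerivAt (fun t => ∫ u in (0 : ℝ)..t, φ u) 0 0) :
    Tendsto (fun r => ∫ t in (-Real.pi)..Real.pi, φ t * radialPoisson r t) (𝓝[<] 1) (𝓝 0) := by
  have hpi := Real.pi_pos
  set Ψ : ℝ → ℝ := fun t => ∫ u in (0 : ℝ)..t, φ u with hΨ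
  have hac : AbsolutelyContinuousOnInterval Ψ (-Real.pi) Real.pi :=
    hφ.absolutelyContinuousOnInterval_intervalIntegral
      (by rw [Set.uIcc_of_le (by linarith)]; constructor <;> linarith)
  have hΨ0 : Ψ 0 = 0 := by simp [hΨ]
  -- integration by parts
  have hparts : ∀ r, 0 < r → r < 1 → ∫ t in (-Real.pi)..Real.pi, φ t * radialPoisson r t
      = Ψ Real.pi * radialPoisson r Real.pi - Ψ (-Real.pi) * radialPoisson r (-Real.pi)
        - ∫ t in (-Real.pi)..Real.pi, Ψ t * deriv (radialPoisson r) t := by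
    intro r h0 h1
    have hP : AbsolutelyContinuousOnInterval (radialPoisson r) (-Real.pi) Real.pi := by
      refine ContDiffOn.absolutelyContinuousOnInterval (ContDiff.contDiffOn ?_)
      exact contDiff_one_iff_deriv.2
        ⟨fun t => (hasDerivAt_radialPoisson h0 h1 t).differentiableAt,
          continuous_deriv_radialPoisson h0 h1⟩
    have h := hac.integral_mul_deriv_eq_deriv_mul hP
    have h2 : ∫ t in (-Real.pi)..Real.pi, deriv Ψ t * radialPoisson r t
        = ∫ t in (-Real.pi)..Real.pi, φ t * radialPoisson r t := by
      refine intervalIntegral.integral_congr_ae ?_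
      filter_upwards [hφ.ae_hasDerivAt_integral] with t ht ht'
      rw [(ht (Set.uIoc_subset_uIcc ht') 0
        (by rw [Set.uIcc_of_le (by linarith)]; constructor <;> linarith)).deriv]
    rw [h2] at h
    linarith
  obtain ⟨C, hC⟩ := hac.exists_bound
  have hC' : ∀ t, |t| ≤ Real.pi → |Ψ t| ≤ C := fun t ht => by
    have := hC t (by rw [Set.uIcc_of_le (by linarith)]; exact abs_le.1 ht)
    simpa using this
  have hC0 : 0 ≤ C := (abs_nonneg _).trans (hC' 0 (by simpa using hpi.le))
  rw [Metric.tendsto_nhds]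
  intro η hη
  -- near `0` the primitive is `o(t)`, elsewhere it is bounded by a multiple of `t ^ 4`
  obtain ⟨K, hK0, hK⟩ : ∃ K, 0 ≤ K ∧ ∀ t, |t| ≤ Real.pi →
      |Ψ t| ≤ η / (4 * Real.pi) * |t| + K * t ^ 4 := by
    have h1 := hd.isLittleO
    rw [Asymptotics.isLittleO_iff] at h1
    have h2 := h1 (show 0 < η / (4 * Real.pi) by positivity)
    obtain ⟨δ, hδ, h3⟩ := Metric.eventually_nhds_iff.1 h2
    refine ⟨C / δ ^ 4, by positivity, fun t ht => ?_⟩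
    rcases lt_or_ge |t| δ with h | h
    · have h4 := h3 (y := t) (by simpa using h)
      simp only [smul_zero, sub_zero, Real.norm_eq_abs] at h4
      rw [hΨ0, sub_zero] at h4
      have : 0 ≤ C / δ ^ 4 * t ^ 4 := by positivity
      linarith
    · have h5 : C ≤ C / δ ^ 4 * t ^ 4 := by
        rw [div_mul_eq_mul_div, le_div_iff₀ (by positivity)]
        refine mul_le_mul_of_nonneg_left ?_ hC0
        calc δ ^ 4 ≤ |t| ^ 4 := by gcongr
          _ = t ^ 4 := by rw [← abs_pow, abs_of_nonneg (by positivity)]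
      have : 0 ≤ η / (4 * Real.pi) * |t| := by positivity
      linarith [hC' t ht]
  have hlim : Tendsto (fun r : ℝ => 2 * C * ((1 - r) / (1 + r))
      + 2 * Real.pi * (K * (Real.pi ^ 4 / 2 * (1 - r ^ 2)))) (𝓝[<] 1) (𝓝 0) := by
    have : ContinuousAt (fun r : ℝ => 2 * C * ((1 - r) / (1 + r))
      + 2 * Real.pi * (K * (Real.pi ^ 4 / 2 * (1 - r ^ 2)))) 1 := by
      fun_prop (disch := norm_num)
    have h := this.tendsto
    norm_num at h
    exact h.mono_left nhdsWithin_le_nhds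
  filter_upwards [hlim.eventually_lt_const (show 0 < η / 2 by positivity),
    Ioo_mem_nhdsLT (show (1 / 2 : ℝ) < 1 by norm_num)] with r hr1 hr
  have h0 : 0 < r := by linarith [hr.1]
  have h1 : r < 1 := hr.2
  rw [dist_zero_right, Real.norm_eq_abs, hparts r h0 h1]
  have hend : ∀ t, Real.cos t = -1 → radialPoisson r t = (1 - r) / (1 + r) := fun t ht => by
    have : 1 + r ≠ 0 := by linarith
    rw [radialPoisson, poissonDenom, ht, div_eq_div_iff (by nlinarith) this]
    ring
  have he0 : 0 ≤ (1 - r) / (1 + r) := div_nonneg (by linarith) (by linarith)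
  rw [hend Real.pi Real.cos_pi, hend (-Real.pi) (by rw [Real.cos_neg, Real.cos_pi])]
  have hA : |Ψ Real.pi * ((1 - r) / (1 + r))| ≤ C * ((1 - r) / (1 + r)) := by
    rw [abs_mul, abs_of_nonneg he0]
    exact mul_le_mul_of_nonneg_right (hC' _ (abs_of_pos hpi).le) he0
  have hB : |Ψ (-Real.pi) * ((1 - r) / (1 + r))| ≤ C * ((1 - r) / (1 + r)) := by
    rw [abs_mul, abs_of_nonneg he0]
    exact mul_le_mul_of_nonneg_right (hC' _ (by rw [abs_neg, abs_of_pos hpi])) he0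
  have hI : |∫ t in (-Real.pi)..Real.pi, Ψ t * deriv (radialPoisson r) t|
      ≤ η / 2 + 2 * Real.pi * (K * (Real.pi ^ 4 / 2 * (1 - r ^ 2))) := by
    have hb : ∀ t ∈ Set.Icc (-Real.pi) Real.pi, ‖Ψ t * deriv (radialPoisson r) t‖ ≤
        η / (4 * Real.pi) * (-(t * deriv (radialPoisson r) t))
          + K * (Real.pi ^ 4 / 2 * (1 - r ^ 2)) := by
      intro t ht
      have ht' : |t| ≤ Real.pi := abs_le.2 ht
      have e1 : |t| * |deriv (radialPoisson r) t| = -(t * deriv (radialPoisson r) t) := by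
        rw [← abs_mul, abs_of_nonpos (mul_deriv_radialPoisson_nonpos h0 h1 ht')]
      rw [norm_mul, Real.norm_eq_abs, Real.norm_eq_abs]
      calc |Ψ t| * |deriv (radialPoisson r) t|
          ≤ (η / (4 * Real.pi) * |t| + K * t ^ 4) * |deriv (radialPoisson r) t| := by
            gcongr; exact hK t ht'
        _ = η / (4 * Real.pi) * (|t| * |deriv (radialPoisson r) t|)
            + K * (t ^ 4 * |deriv (radialPoisson r) t|) := by ring
        _ ≤ _ := by
            rw [e1]
            have := mul_le_mul_of_nonneg_left
              (pow_four_mul_abs_deriv_radialPoisson_le hr.1 h1 ht') hK0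
            gcongr
    have hcd := continuous_deriv_radialPoisson h0 h1
    have hi1 : IntervalIntegrable (fun t => η / (4 * Real.pi) * (-(t * deriv (radialPoisson r) t)))
        volume (-Real.pi) Real.pi := (by fun_prop : Continuous _).intervalIntegrable _ _
    have h3 := intervalIntegral.norm_integral_le_of_norm_le (a := -Real.pi) (b := Real.pi)
      (by linarith)
      (Eventually.of_forall fun t ht => hb t (Set.Ioc_subset_Icc_self ht))
      (hi1.add intervalIntegrable_const)
    rw [intervalIntegral.integral_add hi1 intervalIntegrable_const,
      intervalIntegral.integral_const_mul, intervalIntegral.integral_neg,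
      intervalIntegral.integral_const, smul_eq_mul, Real.norm_eq_abs] at h3
    refine h3.trans ?_
    have h4 := integral_mul_deriv_radialPoisson h0 h1
    have h5 : η / (4 * Real.pi) * (-∫ t in (-Real.pi)..Real.pi, t * deriv (radialPoisson r) t)
        ≤ η / (4 * Real.pi) * (2 * Real.pi) := by gcongr; linarith
    have h6 : η / (4 * Real.pi) * (2 * Real.pi) = η / 2 := by field_simp; ring
    linarith
  have := abs_sub (Ψ Real.pi * ((1 - r) / (1 + r)) - Ψ (-Real.pi) * ((1 - r) / (1 + r)))
    (∫ t in (-Real.pi)..Real.pi, Ψ t * deriv (radialPoisson r) t)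
  have := abs_sub (Ψ Real.pi * ((1 - r) / (1 + r))) (Ψ (-Real.pi) * ((1 - r) / (1 + r)))
  linarith

/-- **Fatou's theorem**, local form: the Poisson integral of `φ` converges radially to the
derivative of the primitive of `φ`, wherever that derivative exists. -/
theorem tendsto_integral_mul_radialPoisson {φ : ℝ → ℂ} {c : ℂ}
    (hφ : IntervalIntegrable φ volume (-Real.pi) Real.pi)
    (hd : HasDerivAt (fun t => ∫ u in (0 : ℝ)..t, φ u) c 0) :
    Tendsto (fun r => ∫ t in (-Real.pi)..Real.pi, (radialPoisson r t : ℂ) * φ t) (𝓝[<] 1)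
      (𝓝 (2 * Real.pi * c)) := by
  have hpi := Real.pi_pos
  -- both sides are determined by real linear functionals, where the centred real case applies
  have key : ∀ l : ℂ →L[ℝ] ℝ, Tendsto
      (fun r => l (∫ t in (-Real.pi)..Real.pi, (radialPoisson r t : ℂ) * φ t)) (𝓝[<] 1)
      (𝓝 (l (2 * Real.pi * c))) := by
    intro l
    have hlφ : IntervalIntegrable (fun t => l (φ t)) volume (-Real.pi) Real.pi :=
      ⟨l.integrable_comp hφ.1, l.integrable_comp hφ.2⟩
    have hd1 : HasDerivAt (fun t => ∫ u in (0 : ℝ)..t, (l (φ u) - l c)) 0 0 := by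
      have h1 : HasDerivAt (fun t => l (∫ u in (0 : ℝ)..t, φ u) - t * l c) (l c - 1 * l c) 0 :=
        (l.hasFDerivAt.comp_hasDerivAt (0 : ℝ) hd).sub ((hasDerivAt_id' (0 : ℝ)).mul_const (l c))
      rw [one_mul, sub_self] at h1
      refine h1.congr_of_eventuallyEq ?_
      filter_upwards [Ioo_mem_nhds (neg_lt_zero.2 hpi) hpi] with t ht
      have hsub : Set.uIcc 0 t ⊆ Set.uIcc (-Real.pi) Real.pi := by
        rw [Set.uIcc_of_le (by linarith : -Real.pi ≤ Real.pi)]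
        exact Set.uIcc_subset_Icc ⟨by linarith, hpi.le⟩ ⟨ht.1.le, ht.2.le⟩
      rw [intervalIntegral.integral_sub (hlφ.mono_set hsub) intervalIntegrable_const,
        ContinuousLinearMap.intervalIntegral_comp_comm l (hφ.mono_set hsub),
        intervalIntegral.integral_const, sub_zero, smul_eq_mul]
    have h2 := (tendsto_integral_mul_radialPoisson_zero
      (hlφ.sub intervalIntegrable_const) hd1).add_const (2 * Real.pi * l c)
    rw [zero_add] at h2
    have h3 : l (2 * Real.pi * c) = 2 * Real.pi * l c := by
      rw [← smul_eq_mul (2 * Real.pi) (l c), ← map_smul]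
      simp
    rw [h3]
    refine h2.congr' ?_
    filter_upwards [Ioo_mem_nhdsLT (show (0 : ℝ) < 1 by norm_num)] with r hr
    have hP := continuous_radialPoisson hr.1 hr.2
    rw [← ContinuousLinearMap.intervalIntegral_comp_comm l
      (hφ.continuousOn_mul (by fun_prop))]
    have h4 : ∀ t, l ((radialPoisson r t : ℂ) * φ t)
        = (l (φ t) - l c) * radialPoisson r t + radialPoisson r t * l c := fun t => by
      rw [← real_smul, map_smul, smul_eq_mul]; ring
    simp_rw [h4]
    rw [intervalIntegral.integral_add
      ((hlφ.sub intervalIntegrable_const).mul_continuousOn hP.continuousOn)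
      ((by fun_prop : Continuous fun t => radialPoisson r t * l c).intervalIntegrable _ _),
      intervalIntegral.integral_mul_const, integral_radialPoisson hr.1 hr.2]
  have h := (((continuous_ofReal.tendsto _).comp (key reCLM)).add
    (((continuous_ofReal.tendsto _).comp (key imCLM)).mul_const I))
  simpa only [Function.comp_def, reCLM_apply, imCLM_apply, re_add_im] using h

/-! ### Fatou's theorem for `H²` -/

/-- The Poisson integral of the boundary function recovers the power series. Pairing with the
Poisson kernel is continuous on `L²`, so it suffices to know the Poisson formula for monomials. -/
theorem poisson_integral_eq_tsum {c : ℕ → ℂ}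
    {F : Lp ℂ 2 (AddCircle.haarAddCircle (T := 2 * Real.pi))}
    (hF : HasSum (fun n : ℕ => c n • fourierLp (T := 2 * Real.pi) 2 (n : ℤ)) F)
    {w : ℂ} (hw : ‖w‖ < 1) :
    (2 * Real.pi : ℂ)⁻¹ * ∫ θ in (0 : ℝ)..(2 * Real.pi),
      (poissonKernel 0 w (exp (θ * I)) : ℂ) * F (θ : AddCircle (2 * Real.pi))
        = ∑' n, c n * w ^ n := by
  have hcont : Continuous fun x : AddCircle (2 * Real.pi) =>
      (poissonKernel 0 w (fourier 1 x) : ℂ) := by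
    simp only [poissonKernel_def, sub_zero]
    refine continuous_ofReal.comp (Continuous.div (by fun_prop) (by fun_prop) fun x => ?_)
    have h1 : ‖fourier 1 x‖ = 1 := by rw [fourier_apply]; exact Circle.norm_coe _
    have : fourier 1 x - w ≠ 0 := fun h => by rw [sub_eq_zero] at h; rw [h] at h1; linarith
    positivity
  let k : C(AddCircle (2 * Real.pi), ℂ) := ⟨_, hcont⟩
  have hkc : ∀ x, (starRingEnd ℂ) (k x) = k x := fun x => conj_ofReal _
  have hk : ∀ θ : ℝ,
      k (θ : AddCircle (2 * Real.pi)) = poissonKernel 0 w (exp (θ * I)) := fun θ => by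
    have := fourier_two_pi_coe 1 θ
    rw [Nat.cast_one, pow_one] at this
    simp only [k, ContinuousMap.coe_mk, this]
  set K := ContinuousMap.toLp (E := ℂ) 2 (AddCircle.haarAddCircle (T := 2 * Real.pi)) ℂ k with hK
  have hint : ∀ g : AddCircle (2 * Real.pi) → ℂ, ∫ x, k x * g x ∂AddCircle.haarAddCircle
      = (2 * Real.pi : ℂ)⁻¹ * ∫ θ in (0 : ℝ)..(2 * Real.pi),
        (poissonKernel 0 w (exp (θ * I)) : ℂ) * g (θ : AddCircle (2 * Real.pi)) := by
    intro g
    have := AddCircle.intervalIntegral_preimage (2 * Real.pi) 0 (fun x => k x * g x)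
    rw [zero_add] at this
    rw [AddCircle.integral_haarAddCircle, ← this, real_smul]
    simp_rw [hk]
    push_cast
    rfl
  have hKF : inner ℂ K F = (2 * Real.pi : ℂ)⁻¹ * ∫ θ in (0 : ℝ)..(2 * Real.pi),
      (poissonKernel 0 w (exp (θ * I)) : ℂ) * F (θ : AddCircle (2 * Real.pi)) := by
    rw [L2.inner_def, ← hint]
    refine integral_congr_ae ?_
    filter_upwards [ContinuousMap.coeFn_toLp (p := 2) (𝕜 := ℂ)
      (AddCircle.haarAddCircle (T := 2 * Real.pi)) k] with x hx
    rw [hx, RCLike.inner_apply', hkc]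
  have hKn : ∀ n : ℕ, inner ℂ K (fourierLp (T := 2 * Real.pi) 2 (n : ℤ)) = w ^ n := by
    intro n
    rw [hK, fourierLp, ContinuousMap.inner_toLp]
    have h1 := (Differentiable.diffContOnCl (𝕜 := ℂ) (s := Metric.ball 0 1)
      (f := fun z : ℂ => z ^ n) (by fun_prop)).circleAverage_poissonKernel_smul
      (w := w) (by simpa using hw)
    simp only [Real.circleAverage_def, circleMap, ofReal_one, one_mul, zero_add, Pi.smul_apply',
      real_smul] at h1
    simp_rw [hkc, mul_comm _ (k _)]
    rw [hint, ← h1]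
    simp_rw [fourier_two_pi_coe]
    push_cast
    rfl
  rw [← hKF]
  have h := (innerSL ℂ K).hasSum hF
  simp only [innerSL_apply_apply, inner_smul_right, hKn] at h
  exact h.tsum_eq.symm

/-- **Fatou's theorem** for `H²`: a power series with square-summable coefficients has radial limits
almost everywhere on the unit circle, and the `L²` norm of the boundary function is the `ℓ²` norm
of the coefficients. -/
theorem exists_radial_limit {c : ℕ → ℂ} (hc : Summable fun n => ‖c n‖ ^ 2) :
    ∃ F : ℝ → ℂ, (∀ᵐ θ : ℝ, Tendsto (fun r : ℝ => ∑' n, c n * ((r : ℂ) * exp (θ * I)) ^ n)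
      (𝓝[<] 1) (𝓝 (F θ))) ∧
      (2 * Real.pi)⁻¹ * ∫ θ in (0 : ℝ)..(2 * Real.pi), ‖F θ‖ ^ 2 = ∑' n, ‖c n‖ ^ 2 := by
  obtain ⟨F, hF, hn⟩ := exists_hasSum_fourierLp hc
  have hpi := Real.pi_pos
  refine ⟨fun θ => F (θ : AddCircle (2 * Real.pi)), ?_,
    by rw [← hn, norm_sq_lp_eq_intervalIntegral]⟩
  have hint : Integrable F (volume : Measure (AddCircle (2 * Real.pi))) :=
    ((memLp_haarAddCircle_iff.1 (Lp.memLp F)).integrable (by norm_num))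
  have hii : ∀ a b : ℝ, IntervalIntegrable
      (fun θ : ℝ => F (θ : AddCircle (2 * Real.pi))) volume a b := by
    have hper : Function.Periodic (fun θ : ℝ => F (θ : AddCircle (2 * Real.pi))) (2 * Real.pi) :=
      fun θ => by simp
    have h0 : IntervalIntegrable (fun θ : ℝ => F (θ : AddCircle (2 * Real.pi))) volume
        0 (0 + 2 * Real.pi) := by
      rw [intervalIntegrable_iff_integrableOn_Ioc_of_le (by linarith)]
      exact (AddCircle.measurePreserving_mk (2 * Real.pi) 0).integrable_comp_of_integrable hint
    exact fun a b => hper.intervalIntegrable (by linarith) h0 a b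
  have hloc : LocallyIntegrable (fun θ : ℝ => F (θ : AddCircle (2 * Real.pi))) volume := by
    refine (locallyIntegrable_iff).2 fun s hs => ?_
    obtain ⟨R, hR⟩ := hs.isBounded.subset_closedBall 0
    have h1 := (hii (-R) R)
    rcases le_total (-R) R with h | h
    · rw [intervalIntegrable_iff_integrableOn_Icc_of_le h] at h1
      refine h1.mono_set (hR.trans ?_)
      rw [Real.closedBall_eq_Icc, zero_sub, zero_add]
    · have : IntegrableOn (fun θ : ℝ => F (θ : AddCircle (2 * Real.pi))) (Set.Icc (-1) 1) :=
        (intervalIntegrable_iff_integrableOn_Icc_of_le (by norm_num)).1 (hii (-1) 1)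
      refine this.mono_set (hR.trans ?_)
      rw [Real.closedBall_eq_Icc]
      exact Set.Icc_subset_Icc (by linarith) (by linarith)
  filter_upwards [LocallyIntegrable.ae_hasDerivAt_integral hloc] with θ hθ
  have hd : HasDerivAt (fun t => ∫ u in (0 : ℝ)..t, F ((θ + u : ℝ) : AddCircle (2 * Real.pi)))
      (F (θ : AddCircle (2 * Real.pi))) 0 := by
    have h1 : HasDerivAt (fun x => ∫ u in θ..x, F (u : AddCircle (2 * Real.pi)))
      (F (θ : AddCircle (2 * Real.pi))) (θ + 0) := by rw [add_zero]; exact hθ θ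
    have h2 := h1.comp_const_add θ 0
    refine h2.congr_of_eventuallyEq (Eventually.of_forall fun t => ?_)
    have := intervalIntegral.integral_comp_add_left (a := 0) (b := t)
      (fun u : ℝ => F (u : AddCircle (2 * Real.pi))) θ
    rw [add_zero] at this
    exact this
  have hi : IntervalIntegrable (fun u => F ((θ + u : ℝ) : AddCircle (2 * Real.pi))) volume
      (-Real.pi) Real.pi := by
    have := (hii (-Real.pi + θ) (Real.pi + θ)).comp_add_left θ
    simpa using this
  have h := (tendsto_integral_mul_radialPoisson hi hd).const_mul ((2 * Real.pi : ℂ)⁻¹)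
  have hpc : (2 * Real.pi : ℂ) ≠ 0 := by exact_mod_cast Real.two_pi_pos.ne'
  rw [inv_mul_cancel_left₀ hpc] at h
  refine h.congr' ?_
  filter_upwards [Ioo_mem_nhdsLT (show (0 : ℝ) < 1 by norm_num)] with r hr
  have hw : ‖(r : ℂ) * exp (θ * I)‖ < 1 := by
    rw [norm_mul, norm_exp_ofReal_mul_I, mul_one, norm_real, Real.norm_eq_abs, abs_of_pos hr.1]
    exact hr.2
  rw [← poisson_integral_eq_tsum hF hw]
  congr 1
  -- rotate by `θ` and shift the period
  set G : ℝ → ℂ := fun t => (poissonKernel 0 ((r : ℂ) * exp (θ * I)) (exp (t * I)) : ℂ)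
    * F (t : AddCircle (2 * Real.pi)) with hG
  have hper : Function.Periodic G (2 * Real.pi) := fun t => by
    simp only [hG]
    rw [show ((t + 2 * Real.pi : ℝ) : ℂ) * I = t * I + 2 * Real.pi * I by push_cast; ring,
      exp_periodic]
    simp
  have h1 := hper.intervalIntegral_add_eq 0 (-Real.pi + θ)
  rw [zero_add, show -Real.pi + θ + 2 * Real.pi = Real.pi + θ by ring,
    ← intervalIntegral.integral_comp_add_right] at h1
  change _ = ∫ t in (0 : ℝ)..(2 * Real.pi), G t
  rw [h1]
  refine intervalIntegral.integral_congr fun u _ => ?_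
  simp only [hG]
  rw [add_comm u θ, radialPoisson_eq_poissonKernel]
  congr 2
  have hexp : exp (((θ + u : ℝ) : ℂ) * I) = exp (u * I) * exp (θ * I) := by
    rw [← Complex.exp_add]; congr 1; push_cast; ring
  simp only [poissonKernel_def, sub_zero, hexp, ← sub_mul, norm_mul, norm_exp_ofReal_mul_I, mul_one]

/-! ### Taylor coefficients of functions in `H²` and `H^{k,2}` -/

/-- The `n`-th Taylor coefficient of `f` at the origin. -/
noncomputable def taylorCoeff (f : ℂ → ℂ) (n : ℕ) : ℂ := (n.factorial : ℂ)⁻¹ * iteratedDeriv n f 0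

theorem summable_norm_taylorCoeff_mul_pow {f : ℂ → ℂ} (hf : DifferentiableOn ℂ f (Metric.ball 0 1))
    {z : ℂ} (hz : ‖z‖ < 1) : Summable fun n => ‖taylorCoeff f n * z ^ n‖ := by
  have h := (hasSum_taylorSeries_on_ball hf (z := z) (by simpa using hz)).summable.norm
  refine h.congr fun n => ?_
  rw [sub_zero, smul_eq_mul, smul_eq_mul, taylorCoeff]
  congr 1
  ring

theorem tsum_taylorCoeff_mul_pow {f : ℂ → ℂ} (hf : DifferentiableOn ℂ f (Metric.ball 0 1))
    {z : ℂ} (hz : ‖z‖ < 1) : ∑' n, taylorCoeff f n * z ^ n = f z := by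
  simpa [taylorCoeff] using
    taylorSeries_eq_on_ball' (z := z) (c := 0) (r := 1) (by simpa using hz) hf

theorem norm_ofReal_mul_exp {r : ℝ} (h0 : 0 ≤ r) (θ : ℝ) : ‖(r : ℂ) * exp (θ * I)‖ = r := by
  rw [norm_mul, norm_exp_ofReal_mul_I, mul_one, norm_real, Real.norm_eq_abs, abs_of_nonneg h0]

theorem integralMean_sq {f : ℂ → ℂ} (hf : DifferentiableOn ℂ f (Metric.ball 0 1)) {r : ℝ}
    (h0 : 0 ≤ r) (h1 : r < 1) :
    integralMean f r ^ 2 = ∑' n, ‖taylorCoeff f n‖ ^ 2 * r ^ (2 * n) := by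
  have hs : Summable fun n => ‖taylorCoeff f n * (r : ℂ) ^ n‖ :=
    summable_norm_taylorCoeff_mul_pow hf (by rwa [norm_real, Real.norm_eq_abs, abs_of_nonneg h0])
  have hp := parseval_of_summable hs
  have hnn : 0 ≤ (2 * Real.pi)⁻¹ *
      ∫ θ in (0 : ℝ)..(2 * Real.pi), ‖f ((r : ℂ) * exp ((θ : ℂ) * I))‖ ^ 2 :=
    mul_nonneg (by positivity) (intervalIntegral.integral_nonneg Real.two_pi_pos.le
      fun θ _ => by positivity)
  rw [integralMean, Real.sq_sqrt hnn]
  have h2 : ∀ θ : ℝ, f ((r : ℂ) * exp ((θ : ℂ) * I))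
      = ∑' n, taylorCoeff f n * (r : ℂ) ^ n * exp (θ * I) ^ n := fun θ => by
    rw [← tsum_taylorCoeff_mul_pow hf (by rwa [norm_ofReal_mul_exp h0])]
    simp_rw [mul_pow, mul_assoc]
  simp_rw [h2, hp]
  refine tsum_congr fun n => ?_
  rw [norm_mul, norm_pow, norm_real, Real.norm_eq_abs, abs_of_nonneg h0]
  ring

theorem summable_sq_taylorCoeff_mul_pow {f : ℂ → ℂ} (hf : DifferentiableOn ℂ f (Metric.ball 0 1))
    {r : ℝ} (h0 : 0 ≤ r) (h1 : r < 1) :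
    Summable fun n => ‖taylorCoeff f n‖ ^ 2 * r ^ (2 * n) := by
  have hs : Summable fun n => ‖taylorCoeff f n * (r : ℂ) ^ n‖ :=
    summable_norm_taylorCoeff_mul_pow hf (by rwa [norm_real, Real.norm_eq_abs, abs_of_nonneg h0])
  refine Summable.of_norm_bounded_eventually_nat hs ?_
  filter_upwards [hs.tendsto_atTop_zero.eventually_le_const one_pos] with n hn
  have h2 : ‖taylorCoeff f n‖ ^ 2 * r ^ (2 * n) = ‖taylorCoeff f n * (r : ℂ) ^ n‖ ^ 2 := by
    rw [norm_mul, norm_pow, norm_real, Real.norm_eq_abs, abs_of_nonneg h0]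
    ring
  rw [h2, norm_pow, norm_norm, sq]
  exact mul_le_of_le_one_left (norm_nonneg _) hn

theorem integralMean_mono {f : ℂ → ℂ} (hf : DifferentiableOn ℂ f (Metric.ball 0 1)) {r R : ℝ}
    (h0 : 0 ≤ r) (hrR : r ≤ R) (h1 : R < 1) : integralMean f r ≤ integralMean f R := by
  refine le_of_sq_le_sq ?_ (Real.sqrt_nonneg _)
  rw [integralMean_sq hf h0 (hrR.trans_lt h1), integralMean_sq hf (h0.trans hrR) h1]
  refine Summable.tsum_le_tsum (fun n => ?_)
    (summable_sq_taylorCoeff_mul_pow hf h0 (hrR.trans_lt h1))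
    (summable_sq_taylorCoeff_mul_pow hf (h0.trans hrR) h1)
  gcongr

theorem MemH2.summable_sq_taylorCoeff {f : ℂ → ℂ} (hf : MemH2 f) :
    Summable fun n => ‖taylorCoeff f n‖ ^ 2 := by
  obtain ⟨hd, C, hC⟩ := hf
  refine summable_of_sum_range_le (c := C ^ 2) (fun n => by positivity) fun N => ?_
  have hcont : Continuous fun r : ℝ =>
      ∑ n ∈ Finset.range N, ‖taylorCoeff f n‖ ^ 2 * r ^ (2 * n) := by fun_prop
  have hlim : Tendsto (fun r : ℝ => ∑ n ∈ Finset.range N, ‖taylorCoeff f n‖ ^ 2 * r ^ (2 * n))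
      (𝓝[<] 1) (𝓝 (∑ n ∈ Finset.range N, ‖taylorCoeff f n‖ ^ 2)) := by
    have := hcont.tendsto 1
    simp only [one_pow, mul_one] at this
    exact this.mono_left nhdsWithin_le_nhds
  refine le_of_tendsto hlim ?_
  filter_upwards [Ioo_mem_nhdsLT (show (0 : ℝ) < 1 by norm_num)] with r hr
  calc ∑ n ∈ Finset.range N, ‖taylorCoeff f n‖ ^ 2 * r ^ (2 * n)
      ≤ ∑' n, ‖taylorCoeff f n‖ ^ 2 * r ^ (2 * n) :=
        (summable_sq_taylorCoeff_mul_pow hd hr.1.le hr.2).sum_le_tsum _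
          fun n _ => mul_nonneg (by positivity) (pow_nonneg hr.1.le _)
    _ = integralMean f r ^ 2 := (integralMean_sq hd hr.1.le hr.2).symm
    _ ≤ C ^ 2 := pow_le_pow_left₀ (Real.sqrt_nonneg _) (hC r ⟨hr.1.le, hr.2⟩) 2

/-- The boundary norm of an `H²` function is the `ℓ²` norm of its Taylor coefficients. -/
theorem MemH2.norm2_sq {f : ℂ → ℂ} (hf : MemH2 f) :
    norm2 f ^ 2 = ∑' n, ‖taylorCoeff f n‖ ^ 2 := by
  obtain ⟨F, hF, hn⟩ := exists_radial_limit hf.summable_sq_taylorCoeff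
  have hnn : 0 ≤ (2 * Real.pi)⁻¹ *
      ∫ θ in (0 : ℝ)..(2 * Real.pi), ‖boundaryValue f θ‖ ^ 2 :=
    mul_nonneg (by positivity) (intervalIntegral.integral_nonneg Real.two_pi_pos.le
      fun θ _ => by positivity)
  rw [norm2, Real.sq_sqrt hnn, ← hn]
  congr 1
  refine intervalIntegral.integral_congr_ae ?_
  filter_upwards [hF] with θ hθ _
  have : boundaryValue f θ = F θ := by
    refine Tendsto.limUnder_eq (hθ.congr' ?_)
    filter_upwards [Ioo_mem_nhdsLT (show (0 : ℝ) < 1 by norm_num)] with r hr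
    exact tsum_taylorCoeff_mul_pow hf.1 (by rw [norm_ofReal_mul_exp hr.1.le]; exact hr.2)
  rw [this]

/-- If the Taylor coefficients are absolutely summable, radial limits exist everywhere. -/
theorem tendsto_boundary_of_summable {c : ℕ → ℂ} (hc : Summable fun n => ‖c n‖) (θ : ℝ) :
    Tendsto (fun r : ℝ => ∑' n, c n * ((r : ℂ) * exp (θ * I)) ^ n) (𝓝[<] 1)
      (𝓝 (∑' n, c n * exp (θ * I) ^ n)) := by
  refine tendsto_tsum_of_dominated_convergence hc (fun n => ?_) ?_
  · have : Continuous fun r : ℝ => c n * ((r : ℂ) * exp (θ * I)) ^ n := by fun_prop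
    have h := this.tendsto 1
    rw [ofReal_one, one_mul] at h
    exact h.mono_left nhdsWithin_le_nhds
  · filter_upwards [Ioo_mem_nhdsLT (show (0 : ℝ) < 1 by norm_num)] with r hr n
    rw [norm_mul, norm_pow, norm_ofReal_mul_exp hr.1.le]
    exact mul_le_of_le_one_right (norm_nonneg _) (pow_le_one₀ hr.1.le hr.2.le)

theorem boundaryValue_eq_tsum {f : ℂ → ℂ} (hf : DifferentiableOn ℂ f (Metric.ball 0 1))
    (hs : Summable fun n => ‖taylorCoeff f n‖) (θ : ℝ) :
    boundaryValue f θ = ∑' n, taylorCoeff f n * exp (θ * I) ^ n := by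
  refine Tendsto.limUnder_eq ((tendsto_boundary_of_summable hs θ).congr' ?_)
  filter_upwards [Ioo_mem_nhdsLT (show (0 : ℝ) < 1 by norm_num)] with r hr
  exact tsum_taylorCoeff_mul_pow hf (by rw [norm_ofReal_mul_exp hr.1.le]; exact hr.2)

/-- The Taylor coefficients of `f^{(k)}` are `(n + k)! / n!` times those of `f`, and this factor is
at least `(n + 1) ^ k`. -/
theorem pow_mul_norm_taylorCoeff_le (f : ℂ → ℂ) (k n : ℕ) :
    ((n : ℝ) + 1) ^ k * ‖taylorCoeff f (n + k)‖ ≤ ‖taylorCoeff (iteratedDeriv k f) n‖ := by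
  have h1 : iteratedDeriv n (iteratedDeriv k f) = iteratedDeriv (n + k) f := by
    simp only [iteratedDeriv_eq_iterate, Function.iterate_add_apply]
  have h2 : ((n : ℝ) + 1) ^ k * n.factorial ≤ (n + k).factorial := by
    have := Nat.factorial_mul_pow_le_factorial (n := k) (m := n)
    rw [mul_comm]
    exact_mod_cast this
  rw [taylorCoeff, taylorCoeff, h1, norm_mul, norm_mul, norm_inv, norm_inv, norm_natCast,
    norm_natCast, ← mul_assoc]
  refine mul_le_mul_of_nonneg_right ?_ (norm_nonneg _)
  rw [← div_eq_mul_inv, div_le_iff₀ (by positivity), ← div_eq_inv_mul, le_div_iff₀ (by positivity)]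
  exact h2

/-- Membership in the unit ball of `H^{k,2}` in terms of Taylor coefficients. Only the norm of the
`k`-th derivative is used. -/
theorem sum_pow_mul_taylorCoeff_le {k : ℕ} {f : ℂ → ℂ} (hf : f ∈ unitBall k) :
    Summable (fun n : ℕ => ((n : ℝ) + 1) ^ (2 * k) * ‖taylorCoeff f (n + k)‖ ^ 2) ∧
      ∑' n : ℕ, ((n : ℝ) + 1) ^ (2 * k) * ‖taylorCoeff f (n + k)‖ ^ 2 ≤ 1 := by
  have hH := hf.1 k le_rfl
  have hle : ∀ n : ℕ, ((n : ℝ) + 1) ^ (2 * k) * ‖taylorCoeff f (n + k)‖ ^ 2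
      ≤ ‖taylorCoeff (iteratedDeriv k f) n‖ ^ 2 := fun n => by
    calc _ = (((n : ℝ) + 1) ^ k * ‖taylorCoeff f (n + k)‖) ^ 2 := by ring
      _ ≤ _ := pow_le_pow_left₀ (by positivity) (pow_mul_norm_taylorCoeff_le f k n) 2
  have hs := Summable.of_nonneg_of_le (fun n => by positivity) hle hH.summable_sq_taylorCoeff
  refine ⟨hs, (hs.tsum_le_tsum hle hH.summable_sq_taylorCoeff).trans ?_⟩
  rw [← hH.norm2_sq]
  have h1 := hf.2
  rw [normk2, Real.sqrt_le_one] at h1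
  exact (Finset.single_le_sum (f := fun j => norm2 (iteratedDeriv j f) ^ 2)
    (fun j _ => sq_nonneg _) (Finset.mem_range.2 (Nat.lt_succ_self k))).trans h1

theorem summable_norm_taylorCoeff {k : ℕ} (hk : 1 ≤ k) {f : ℂ → ℂ} (hf : f ∈ unitBall k) :
    Summable fun n => ‖taylorCoeff f n‖ := by
  rw [← summable_nat_add_iff k]
  have h2 : Summable fun n : ℕ => 1 / ((n : ℝ) + 1) ^ 2 := by
    have := (summable_nat_add_iff 1).2 (Real.summable_one_div_nat_pow.2 one_lt_two)
    simpa using this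
  refine Summable.of_nonneg_of_le (fun n => norm_nonneg _) (fun n => ?_)
    ((sum_pow_mul_taylorCoeff_le hf).1.add h2)
  set x := ‖taylorCoeff f (n + k)‖
  have hx : 0 ≤ x := norm_nonneg _
  have h3 : ((n : ℝ) + 1) ^ 2 ≤ ((n : ℝ) + 1) ^ (2 * k) :=
    pow_le_pow_right₀ (by linarith [n.cast_nonneg (α := ℝ)]) (by omega)
  -- `x` is a product of terms of two square-summable sequences
  have h4 : x = (((n : ℝ) + 1) * x) * (1 / ((n : ℝ) + 1)) := by
    have : (n : ℝ) + 1 ≠ 0 := by positivity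
    field_simp
  have h5 : 1 / ((n : ℝ) + 1) ^ 2 = (1 / ((n : ℝ) + 1)) ^ 2 := by rw [div_pow, one_pow]
  have h6 : ((n : ℝ) + 1) ^ 2 * x ^ 2 ≤ ((n : ℝ) + 1) ^ (2 * k) * x ^ 2 := by gcongr
  rw [h5]
  nlinarith [two_mul_le_add_sq (((n : ℝ) + 1) * x) (1 / ((n : ℝ) + 1)),
    sq_nonneg (((n : ℝ) + 1) * x), sq_nonneg (1 / ((n : ℝ) + 1))]

/-! ### Harmonic measure of an arc -/

theorem continuous_poissonKernel_exp {w : ℂ} (hw : ‖w‖ < 1) :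
    Continuous fun t : ℝ => poissonKernel 0 w (exp (t * I)) := by
  simp only [poissonKernel_def, sub_zero]
  refine Continuous.div (by fun_prop) (by fun_prop) fun t => ?_
  have : exp (t * I) - w ≠ 0 := fun h => by
    have h1 := norm_exp_ofReal_mul_I t
    rw [sub_eq_zero.1 h] at h1
    linarith
  positivity

theorem poissonKernel_exp_nonneg {w : ℂ} (hw : ‖w‖ < 1) (t : ℝ) :
    0 ≤ poissonKernel 0 w (exp (t * I)) := by
  rw [poissonKernel_def, sub_zero, sub_zero, norm_exp_ofReal_mul_I]
  exact div_nonneg (by nlinarith [norm_nonneg w]) (sq_nonneg _)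

/-- Harnack's lower bound. -/
theorem le_poissonKernel_exp {w : ℂ} (hw : ‖w‖ < 1) (t : ℝ) :
    (1 - ‖w‖) / (1 + ‖w‖) ≤ poissonKernel 0 w (exp (t * I)) := by
  have h := le_re_herglotzRieszKernel (c := 0) (R := 1) (z := exp (t * I)) (w := w)
    (by simp [norm_exp_ofReal_mul_I]) (by simpa using hw)
  rw [poissonKernel_eq_re_herglotzRieszKernel]
  simpa [herglotzRieszKernel_def] using h

/-- An analytic function on the disk whose real part is the harmonic measure of the arc
`{e^{it} : 0 < t ≤ 2π lam}`, namely the Herglotz integral of the indicator of that arc. -/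
theorem exists_re_eq_harmonicMeasure {lam : ℝ} (h0 : 0 < lam) (h1 : lam < 1) :
    ∃ h : ℂ → ℂ, DifferentiableOn ℂ h (Metric.ball 0 1) ∧ ∀ w, ‖w‖ < 1 →
      (h w).re = (2 * Real.pi)⁻¹ *
        ∫ t in (0 : ℝ)..(2 * Real.pi * lam), poissonKernel 0 w (exp (t * I)) := by
  have hpi := Real.pi_pos
  have hlt : 2 * Real.pi * lam ≤ 2 * Real.pi := by nlinarith
  have hpos : 0 < 2 * Real.pi * lam := by positivity
  set A : Set ℝ := Set.Ioc 0 (2 * Real.pi * lam) with hA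
  have hAsub : A ⊆ Set.Ioc 0 (2 * Real.pi) := Set.Ioc_subset_Ioc_right hlt
  have hinj : Set.InjOn (circleMap 0 1) (Set.Ioc 0 (2 * Real.pi)) := by
    have := injOn_circleMap_of_abs_sub_le (a := 0) (b := 2 * Real.pi) (c := 0) (R := 1) one_ne_zero
      (by simp [abs_of_pos hpi])
    rwa [Set.uIoc_of_le (by linarith)] at this
  set g : ℂ → ℝ := (circleMap 0 1 '' A).indicator 1 with hg
  have hgA : ∀ t ∈ Set.Ioc 0 (2 * Real.pi), g (circleMap 0 1 t) = A.indicator 1 t := fun t ht => by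
    have hiff := hinj.mem_image_iff hAsub ht
    by_cases htA : t ∈ A
    · rw [hg, Set.indicator_of_mem htA, Set.indicator_of_mem (hiff.2 htA), Pi.one_apply,
        Pi.one_apply]
    · rw [hg, Set.indicator_of_notMem htA, Set.indicator_of_notMem (mt hiff.1 htA)]
  have hgi : CircleIntegrable g 0 1 := by
    have h2 : IntervalIntegrable (A.indicator (1 : ℝ → ℝ)) volume 0 (2 * Real.pi) := by
      rw [intervalIntegrable_iff]
      refine IntegrableOn.indicator ?_ measurableSet_Ioc
      rw [← intervalIntegrable_iff]
      exact intervalIntegrable_const (c := (1 : ℝ))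
    refine h2.congr fun t ht => ?_
    rw [Set.uIoc_of_le (by linarith)] at ht
    exact (hgA t ht).symm
  have hgi' : CircleIntegrable (fun ζ => (g ζ : ℂ)) 0 1 := by
    simp only [CircleIntegrable, intervalIntegrable_iff] at hgi ⊢
    exact ofRealCLM.integrable_comp hgi
  refine ⟨_, differentiableOn_circleAverage_herglotzRieszKernel_smul hgi', fun w hw => ?_⟩
  rw [re_circleAverage_herglotzRieszKernel_smul hgi (by simpa using hw),
    ← poissonKernel_eq_re_herglotzRieszKernel, Real.circleAverage_def, smul_eq_mul]
  congr 1
  have hae : ∀ t ∈ Set.uIcc 0 (2 * Real.pi), t ∈ Set.uIoc 0 (2 * Real.pi) →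
      (poissonKernel 0 w • g) (circleMap 0 1 t)
        = A.indicator (fun t : ℝ => poissonKernel 0 w (exp (t * I))) t := fun t _ ht => by
    rw [Set.uIoc_of_le (by linarith)] at ht
    rw [Pi.smul_apply', smul_eq_mul, hgA t ht]
    by_cases htA : t ∈ A <;> simp [htA, circleMap]
  rw [intervalIntegral.integral_congr_ae (ae_of_all _ fun t ht =>
    hae t (Set.uIoc_subset_uIcc ht) ht)]
  rw [intervalIntegral.integral_of_le (by linarith), intervalIntegral.integral_of_le hpos.le,
    setIntegral_indicator measurableSet_Ioc, Set.inter_eq_right.2 hAsub]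

theorem le_harmonicMeasure {lam : ℝ} (h0 : 0 < lam) {w : ℂ} (hw : ‖w‖ < 1) :
    lam * ((1 - ‖w‖) / (1 + ‖w‖)) ≤ (2 * Real.pi)⁻¹ *
        ∫ t in (0 : ℝ)..(2 * Real.pi * lam), poissonKernel 0 w (exp (t * I)) := by
  have hpi := Real.pi_pos
  have h := intervalIntegral.integral_mono_on (a := 0) (b := 2 * Real.pi * lam) (μ := volume)
    (f := fun _ => (1 - ‖w‖) / (1 + ‖w‖)) (by positivity)
    intervalIntegrable_const ((continuous_poissonKernel_exp hw).intervalIntegrable _ _)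
    (fun t _ => le_poissonKernel_exp hw t)
  rw [intervalIntegral.integral_const, smul_eq_mul, sub_zero] at h
  calc lam * ((1 - ‖w‖) / (1 + ‖w‖))
      = (2 * Real.pi)⁻¹ * (2 * Real.pi * lam * ((1 - ‖w‖) / (1 + ‖w‖))) := by
        field_simp
    _ ≤ _ := by gcongr

theorem harmonicMeasure_le_one {lam : ℝ} (h0 : 0 < lam) (h1 : lam < 1) {w : ℂ} (hw : ‖w‖ < 1) :
    (2 * Real.pi)⁻¹ *
        ∫ t in (0 : ℝ)..(2 * Real.pi * lam), poissonKernel 0 w (exp (t * I)) ≤ 1 := by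
  have hpi := Real.pi_pos
  rw [← circleAverage_poissonKernel hw]
  gcongr
  refine intervalIntegral.integral_mono_interval le_rfl (by positivity) (by nlinarith)
    (ae_of_all _ fun t => poissonKernel_exp_nonneg hw t)
    ((continuous_poissonKernel_exp hw).intervalIntegrable _ _)

/-- The harmonic measure of the arc tends to zero radially at points off the closed arc. -/
theorem tendsto_harmonicMeasure_zero {lam θ : ℝ} (h0 : 0 < lam)
    (hθ : θ ∈ Set.Ioo (2 * Real.pi * lam) (2 * Real.pi)) :
    Tendsto (fun r : ℝ => (2 * Real.pi)⁻¹ * ∫ t in (0 : ℝ)..(2 * Real.pi * lam),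
      poissonKernel 0 ((r : ℂ) * exp (θ * I)) (exp (t * I))) (𝓝[<] 1) (𝓝 0) := by
  have hpi := Real.pi_pos
  have hpos : 0 < 2 * Real.pi * lam := by positivity
  -- the distance from `e^{iθ}` to the closed arc is positive
  obtain ⟨δ, hδ, hdist⟩ : ∃ δ > 0, ∀ t ∈ Set.Icc 0 (2 * Real.pi * lam),
      δ ≤ ‖exp (t * I) - exp (θ * I)‖ := by
    obtain ⟨t₀, ht₀, hmin⟩ := (isCompact_Icc (a := 0) (b := 2 * Real.pi * lam)).exists_isMinOn
      ⟨0, by simp [hpos.le]⟩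
      (f := fun t : ℝ => ‖exp (t * I) - exp (θ * I)‖) (by fun_prop)
    refine ⟨_, ?_, fun t ht => hmin ht⟩
    refine norm_pos_iff.2 (sub_ne_zero.2 fun heq => ?_)
    have h2 := injOn_circleMap_of_abs_sub_le' (a := 0) (b := 2 * Real.pi) (c := 0) (R := 1)
      one_ne_zero (by simp) (show t₀ ∈ _ from ⟨ht₀.1, ht₀.2.trans_lt (hθ.1.trans hθ.2)⟩)
      (show θ ∈ _ from ⟨(hpos.trans hθ.1).le, hθ.2⟩) (by simpa [circleMap] using heq)
    linarith [ht₀.2, hθ.1]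
  have hlim : Tendsto (fun r : ℝ => 4 * lam / δ ^ 2 * (1 - r ^ 2)) (𝓝[<] 1) (𝓝 0) := by
    have : Continuous fun r : ℝ => 4 * lam / δ ^ 2 * (1 - r ^ 2) := by fun_prop
    have h := this.tendsto 1
    norm_num at h
    exact h.mono_left nhdsWithin_le_nhds
  refine tendsto_of_tendsto_of_tendsto_of_le_of_le' tendsto_const_nhds hlim ?_ ?_
  · filter_upwards [Ioo_mem_nhdsLT (show (0 : ℝ) < 1 by norm_num)] with r hr
    refine mul_nonneg (by positivity) (intervalIntegral.integral_nonneg hpos.le fun t _ => ?_)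
    exact poissonKernel_exp_nonneg (by rw [norm_ofReal_mul_exp hr.1.le]; exact hr.2) t
  · filter_upwards [Ioo_mem_nhdsLT (show (0 : ℝ) < 1 by norm_num)] with r hr
    have hw : ‖(r : ℂ) * exp (θ * I)‖ < 1 := by rw [norm_ofReal_mul_exp hr.1.le]; exact hr.2
    have hb : ∀ t ∈ Set.Icc 0 (2 * Real.pi * lam),
        poissonKernel 0 ((r : ℂ) * exp (θ * I)) (exp (t * I)) ≤ 4 / δ ^ 2 * (1 - r ^ 2) := by
      intro t ht
      -- `|ζ - ζ'| ≤ |ζ - r ζ'| + (1 - r) ≤ 2 |ζ - r ζ'|` for unimodular `ζ`, `ζ'`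
      have h2 : δ / 2 ≤ ‖exp (t * I) - r * exp (θ * I)‖ := by
        have e1 : ‖exp (θ * I) - r * exp (θ * I)‖ = 1 - r := by
          rw [← one_sub_mul, norm_mul, norm_exp_ofReal_mul_I, mul_one]
          rw [show (1 : ℂ) - r = ((1 - r : ℝ) : ℂ) by push_cast; rfl, norm_real, Real.norm_eq_abs,
            abs_of_pos (by linarith [hr.2])]
        have e2 : 1 - r ≤ ‖exp (t * I) - r * exp (θ * I)‖ := by
          have := norm_sub_norm_le (exp (t * I)) (r * exp (θ * I))
          rwa [norm_exp_ofReal_mul_I, norm_ofReal_mul_exp hr.1.le] at this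
        have e3 := norm_sub_le (exp (t * I) - r * exp (θ * I))
          (exp (θ * I) - r * exp (θ * I))
        rw [sub_sub_sub_cancel_right] at e3
        linarith [hdist t ht]
      rw [poissonKernel_def, sub_zero, sub_zero, norm_exp_ofReal_mul_I,
        norm_ofReal_mul_exp hr.1.le, one_pow]
      have h3 : 0 ≤ 1 - r ^ 2 := by nlinarith [hr.1, hr.2]
      calc (1 - r ^ 2) / ‖exp (t * I) - r * exp (θ * I)‖ ^ 2
          ≤ (1 - r ^ 2) / (δ / 2) ^ 2 := by gcongr
        _ = _ := by field_simp; norm_num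
    have h := intervalIntegral.integral_mono_on (μ := volume) hpos.le
      ((continuous_poissonKernel_exp hw).intervalIntegrable _ _) intervalIntegrable_const hb
    rw [intervalIntegral.integral_const, smul_eq_mul, sub_zero] at h
    calc _ ≤ (2 * Real.pi)⁻¹ * (2 * Real.pi * lam * (4 / δ ^ 2 * (1 - r ^ 2))) := by gcongr
      _ = _ := by field_simp

/-! ### The two-constants estimate -/

theorem differentiableOn_tsum_mul_pow {c : ℕ → ℂ} (hc : Summable fun n => ‖c n‖) :
    DifferentiableOn ℂ (fun z => ∑' n, c n * z ^ n) (Metric.ball 0 1) := by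
  refine differentiableOn_tsum_of_summable_norm hc (fun n => by fun_prop) Metric.isOpen_ball
    fun n z hz => ?_
  rw [norm_mul, norm_pow]
  exact mul_le_of_le_one_right (norm_nonneg _)
    (pow_le_one₀ (norm_nonneg _) (by simpa using (mem_ball_zero_iff.1 hz).le))

theorem norm_tsum_mul_pow_le {c : ℕ → ℂ} (hc : Summable fun n => ‖c n‖) {z : ℂ} (hz : ‖z‖ ≤ 1) :
    ‖∑' n, c n * z ^ n‖ ≤ ∑' n, ‖c n‖ := by
  refine tsum_of_norm_bounded hc.hasSum fun n => ?_
  rw [norm_mul, norm_pow]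
  exact mul_le_of_le_one_right (norm_nonneg _) (pow_le_one₀ (norm_nonneg _) hz)

theorem continuous_tsum_mul_exp_pow {c : ℕ → ℂ} (hc : Summable fun n => ‖c n‖) :
    Continuous fun θ : ℝ => ∑' n, c n * exp (θ * I) ^ n := by
  refine continuous_tsum (fun n => by fun_prop) hc fun n θ => ?_
  rw [norm_mul, norm_pow, norm_exp_ofReal_mul_I, one_pow, mul_one]

theorem continuous_comp_circle {f : ℂ → ℂ} (hf : DifferentiableOn ℂ f (Metric.ball 0 1)) {r : ℝ}
    (h0 : 0 ≤ r) (h1 : r < 1) : Continuous fun θ : ℝ => f ((r : ℂ) * exp (θ * I)) :=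
  hf.continuousOn.comp_continuous (by fun_prop) fun θ => by
    rw [mem_ball_zero_iff, norm_ofReal_mul_exp h0]; exact h1

theorem integralMean_sq_eq_integral (f : ℂ → ℂ) (r : ℝ) :
    integralMean f r ^ 2 = (2 * Real.pi)⁻¹ *
      ∫ θ in (0 : ℝ)..(2 * Real.pi), ‖f ((r : ℂ) * exp (θ * I))‖ ^ 2 :=
  Real.sq_sqrt (mul_nonneg (by positivity) (intervalIntegral.integral_nonneg Real.two_pi_pos.le
    fun θ _ => by positivity))

theorem integralMean_tsum_sq {c : ℕ → ℂ} (hc : Summable fun n => ‖c n‖) {r : ℝ}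
    (h0 : 0 ≤ r) (h1 : r ≤ 1) :
    integralMean (fun z => ∑' n, c n * z ^ n) r ^ 2 = ∑' n, ‖c n‖ ^ 2 * r ^ (2 * n) := by
  have hs : Summable fun n => ‖c n * (r : ℂ) ^ n‖ := by
    refine hc.of_nonneg_of_le (fun n => norm_nonneg _) fun n => ?_
    rw [norm_mul, norm_pow, norm_real, Real.norm_eq_abs, abs_of_nonneg h0]
    exact mul_le_of_le_one_right (norm_nonneg _) (pow_le_one₀ h0 h1)
  rw [integralMean_sq_eq_integral]
  simp_rw [mul_pow, ← mul_assoc]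
  rw [parseval_of_summable hs]
  refine tsum_congr fun n => ?_
  rw [norm_mul, norm_pow, norm_real, Real.norm_eq_abs, abs_of_nonneg h0]
  ring

/-- **Two-constants estimate** in `H²`: if the `L²` norm of the boundary function is at most `s`,
and its normalized `L²` norm on an arc of length `2π lam` is at most `ε`, then the square of the mean on
the circle of radius `r` is at most `2 s² (ε/s) ^ (2 lam (1 - r)/(1 + r))`. -/
theorem tsum_mul_pow_le_of_arc {c : ℕ → ℂ} (hc : Summable fun n => ‖c n‖) {lam : ℝ}
    (h0 : 0 < lam) (h1 : lam < 1) {s ε : ℝ} (hε : 0 < ε) (hεs : ε ≤ s)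
    (hs : ∑' n, ‖c n‖ ^ 2 ≤ s ^ 2)
    (harc : ∫ θ in (0 : ℝ)..(2 * Real.pi * lam), ‖∑' n, c n * exp (θ * I) ^ n‖ ^ 2
      ≤ 2 * Real.pi * lam * ε ^ 2) {r : ℝ} (hr0 : 0 < r) (hr1 : r < 1) :
    ∑' n, ‖c n‖ ^ 2 * r ^ (2 * n)
      ≤ 2 * s ^ 2 * Real.exp (-(2 * Real.log (s / ε) * (lam * ((1 - r) / (1 + r))))) := by
  have hpi := Real.pi_pos
  have hpos : 0 < 2 * Real.pi * lam := by positivity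
  have hlt : 2 * Real.pi * lam ≤ 2 * Real.pi := by nlinarith
  have hs0 : 0 < s := hε.trans_le hεs
  obtain ⟨h, hh, hre⟩ := exists_re_eq_harmonicMeasure h0 h1
  set f : ℂ → ℂ := fun z => ∑' n, c n * z ^ n with hf
  set p : ℝ → ℂ := fun θ => ∑' n, c n * exp (θ * I) ^ n with hp
  set B := ∑' n, ‖c n‖ with hB
  set τ := Real.log (s / ε) with hτ
  have hτ0 : 0 ≤ τ := Real.log_nonneg ((one_le_div hε).2 hεs)
  have hexpτ : Real.exp (2 * τ) * ε ^ 2 = s ^ 2 := by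
    rw [two_mul, Real.exp_add, hτ, Real.exp_log (by positivity)]
    field_simp
  have hfd : DifferentiableOn ℂ f (Metric.ball 0 1) := differentiableOn_tsum_mul_pow hc
  set g : ℂ → ℂ := fun z => f z * exp (τ * h z) with hg
  have hgd : DifferentiableOn ℂ g (Metric.ball 0 1) := hfd.mul ((hh.const_mul _).cexp)
  have hgn : ∀ z, ‖g z‖ ^ 2 = ‖f z‖ ^ 2 * Real.exp (2 * τ * (h z).re) := fun z => by
    rw [hg, norm_mul, norm_exp, re_ofReal_mul, mul_pow, ← Real.exp_nat_mul]
    congr 2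
    push_cast
    ring
  have hball : ∀ R ∈ Set.Ioo (0 : ℝ) 1, ∀ θ : ℝ, ‖(R : ℂ) * exp (θ * I)‖ < 1 := fun R hR θ => by
    rw [norm_ofReal_mul_exp hR.1.le]; exact hR.2
  have hgle : ∀ z, ‖z‖ < 1 → ‖g z‖ ^ 2 ≤ ‖f z‖ ^ 2 * Real.exp (2 * τ) := fun z hz => by
    have hle1 : (h z).re ≤ 1 := by rw [hre z hz]; exact harmonicMeasure_le_one h0 h1 hz
    rw [hgn]
    refine mul_le_mul_of_nonneg_left (Real.exp_le_exp.2 ?_) (by positivity)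
    exact mul_le_of_le_one_right (by positivity) hle1
  have hfB : ∀ z, ‖z‖ < 1 → ‖f z‖ ^ 2 ≤ B ^ 2 := fun z hz =>
    pow_le_pow_left₀ (norm_nonneg _) (norm_tsum_mul_pow_le hc hz.le) 2
  have hfc : ∀ R ∈ Set.Ioo (0 : ℝ) 1, Continuous fun θ : ℝ => f ((R : ℂ) * exp (θ * I)) :=
    fun R hR => continuous_comp_circle hfd hR.1.le hR.2
  have hgc : ∀ R ∈ Set.Ioo (0 : ℝ) 1, Continuous fun θ : ℝ => g ((R : ℂ) * exp (θ * I)) :=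
    fun R hR => continuous_comp_circle hgd hR.1.le hR.2
  have hftend : ∀ θ : ℝ, Tendsto (fun R : ℝ => ‖f ((R : ℂ) * exp (θ * I))‖ ^ 2) (𝓝[<] 1)
      (𝓝 (‖p θ‖ ^ 2)) := fun θ => ((tendsto_boundary_of_summable hc θ).norm).pow 2
  have hev : ∀ᶠ R : ℝ in 𝓝[<] 1, R ∈ Set.Ioo (0 : ℝ) 1 := Ioo_mem_nhdsLT zero_lt_one
  -- the lower bound for the harmonic measure compares the means of `f` and `g` on `|z| = r`
  have hlow : integralMean f r ^ 2 * Real.exp (2 * τ * (lam * ((1 - r) / (1 + r))))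
      ≤ integralMean g r ^ 2 := by
    rw [integralMean_sq_eq_integral, integralMean_sq_eq_integral, mul_assoc,
      ← intervalIntegral.integral_mul_const]
    refine mul_le_mul_of_nonneg_left ?_ (by positivity)
    refine intervalIntegral.integral_mono_on (by positivity) ?_ ?_ fun θ _ => ?_
    · exact (((hfc r ⟨hr0, hr1⟩).norm.pow 2).mul_const _).intervalIntegrable _ _
    · exact ((hgc r ⟨hr0, hr1⟩).norm.pow 2).intervalIntegrable _ _
    · rw [hgn]
      have hz := hball r ⟨hr0, hr1⟩ θ
      have := le_harmonicMeasure h0 hz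
      rw [← hre _ hz, norm_ofReal_mul_exp hr0.le] at this
      gcongr
  -- upper bounds for the means of `g` near the boundary, on the arc and off the arc
  have hlim1 : Tendsto (fun R : ℝ => Real.exp (2 * τ) *
      ∫ θ in (0 : ℝ)..(2 * Real.pi * lam), ‖f ((R : ℂ) * exp (θ * I))‖ ^ 2) (𝓝[<] 1)
      (𝓝 (Real.exp (2 * τ) * ∫ θ in (0 : ℝ)..(2 * Real.pi * lam), ‖p θ‖ ^ 2)) := by
    refine Tendsto.const_mul _ ?_
    refine intervalIntegral.tendsto_integral_filter_of_dominated_convergence (fun _ => B ^ 2) ?_ ?_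
      intervalIntegrable_const (ae_of_all _ fun θ _ => hftend θ)
    · filter_upwards [hev] with R hR
      exact ((hfc R hR).norm.pow 2).aestronglyMeasurable
    · filter_upwards [hev] with R hR
      refine ae_of_all _ fun θ _ => ?_
      rw [norm_pow, norm_norm]
      exact hfB _ (hball R hR θ)
  have hlim2 : Tendsto (fun R : ℝ =>
      ∫ θ in (2 * Real.pi * lam)..(2 * Real.pi), ‖g ((R : ℂ) * exp (θ * I))‖ ^ 2) (𝓝[<] 1)
      (𝓝 (∫ θ in (2 * Real.pi * lam)..(2 * Real.pi), ‖p θ‖ ^ 2)) := by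
    refine intervalIntegral.tendsto_integral_filter_of_dominated_convergence
      (fun _ => B ^ 2 * Real.exp (2 * τ)) ?_ ?_ intervalIntegrable_const ?_
    · filter_upwards [hev] with R hR
      exact ((hgc R hR).norm.pow 2).aestronglyMeasurable
    · filter_upwards [hev] with R hR
      refine ae_of_all _ fun θ _ => ?_
      rw [norm_pow, norm_norm]
      exact (hgle _ (hball R hR θ)).trans
        (mul_le_mul_of_nonneg_right (hfB _ (hball R hR θ)) (Real.exp_pos _).le)
    · filter_upwards [Measure.ae_ne volume (2 * Real.pi)] with θ hne hθ
      rw [Set.uIoc_of_le hlt] at hθ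
      have h2 := tendsto_harmonicMeasure_zero h0 ⟨hθ.1, lt_of_le_of_ne hθ.2 hne⟩
      have h3 : Tendsto (fun R : ℝ => (h ((R : ℂ) * exp (θ * I))).re) (𝓝[<] 1) (𝓝 0) := by
        refine h2.congr' ?_
        filter_upwards [hev] with R hR
        rw [hre _ (hball R hR θ)]
      have h4 := (hftend θ).mul ((Real.continuous_exp.tendsto _).comp (h3.const_mul (2 * τ)))
      simp only [mul_zero, Real.exp_zero, mul_one] at h4
      refine h4.congr fun R => ?_
      rw [hgn, Function.comp_apply]
  have hup : integralMean g r ^ 2 ≤ 2 * s ^ 2 := by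
    have hlim := (hlim1.add hlim2).const_mul ((2 * Real.pi)⁻¹)
    have hbound : integralMean g r ^ 2 ≤ (2 * Real.pi)⁻¹ *
        (Real.exp (2 * τ) * (∫ θ in (0 : ℝ)..(2 * Real.pi * lam), ‖p θ‖ ^ 2) +
          ∫ θ in (2 * Real.pi * lam)..(2 * Real.pi), ‖p θ‖ ^ 2) := by
      refine ge_of_tendsto hlim ?_
      filter_upwards [hev, Ioo_mem_nhdsLT hr1] with R hR hrR
      refine (pow_le_pow_left₀ (Real.sqrt_nonneg _)
        (integralMean_mono hgd hr0.le hrR.1.le hR.2) 2).trans ?_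
      rw [integralMean_sq_eq_integral]
      have hc1 : Continuous fun θ : ℝ => ‖g ((R : ℂ) * exp (θ * I))‖ ^ 2 := (hgc R hR).norm.pow 2
      have hc2 : Continuous fun θ : ℝ => ‖f ((R : ℂ) * exp (θ * I))‖ ^ 2 := (hfc R hR).norm.pow 2
      rw [← intervalIntegral.integral_add_adjacent_intervals (hc1.intervalIntegrable 0
        (2 * Real.pi * lam)) (hc1.intervalIntegrable _ (2 * Real.pi)),
        ← intervalIntegral.integral_const_mul]
      refine mul_le_mul_of_nonneg_left (add_le_add_left ?_ _) (by positivity)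
      refine intervalIntegral.integral_mono_on hpos.le (hc1.intervalIntegrable _ _)
        ((hc2.const_mul _).intervalIntegrable _ _) fun θ _ => ?_
      rw [mul_comm (Real.exp _)]
      exact hgle _ (hball R hR θ)
    have hpc : Continuous fun θ => ‖p θ‖ ^ 2 := (continuous_tsum_mul_exp_pow hc).norm.pow 2
    have htot : ∫ θ in (2 * Real.pi * lam)..(2 * Real.pi), ‖p θ‖ ^ 2 ≤ 2 * Real.pi * s ^ 2 := by
      refine (intervalIntegral.integral_mono_interval hpos.le hlt le_rfl
        (ae_of_all _ fun θ => by positivity) (hpc.intervalIntegrable _ _)).trans ?_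
      have := parseval_of_summable hc
      rw [← this, inv_mul_le_iff₀ (by positivity)] at hs
      exact hs
    have h5 : Real.exp (2 * τ) * (∫ θ in (0 : ℝ)..(2 * Real.pi * lam), ‖p θ‖ ^ 2)
        ≤ 2 * Real.pi * s ^ 2 := by
      calc _ ≤ Real.exp (2 * τ) * (2 * Real.pi * lam * ε ^ 2) := by gcongr
        _ = 2 * Real.pi * lam * (Real.exp (2 * τ) * ε ^ 2) := by ring
        _ ≤ _ := by rw [hexpτ]; gcongr
    refine hbound.trans ?_
    rw [inv_mul_le_iff₀ (by positivity)]
    linarith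
  rw [← integralMean_tsum_sq hc hr0.le hr1.le, Real.exp_neg, ← div_eq_mul_inv,
    le_div_iff₀ (Real.exp_pos _)]
  exact hlow.trans hup

/-! ### Absorption of the high frequencies -/

/-- Absorption: at `r = 1 - 8/N` the weights `r ^ (2n)` are at least `e^{-2}` for `n` up to `N/16`,
so the hypothesis `hdamp` leaves at most half of the sum to these indices, and the tail controls the
other half. -/
theorem tsum_le_of_tail_of_damped {a : ℕ → ℝ} (ha0 : ∀ n, 0 ≤ a n) (ha : Summable a) {k : ℕ}
    (hk : 1 ≤ k) (htail : ∀ m : ℕ, ∑' n, a (n + (m + k)) ≤ 1 / ((m : ℝ) + 1) ^ (2 * k)) {N : ℝ}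
    (hN : 32 * k ≤ N)
    (hdamp : ∑' n, a n * (1 - 8 / N) ^ (2 * n) ≤ 2 * (∑' n, a n) * Real.exp (-4)) :
    ∑' n, a n ≤ 2 * (32 / N) ^ (2 * k) := by
  have hk' : (1 : ℝ) ≤ k := by exact_mod_cast hk
  have hN0 : 0 < N := by linarith
  set r := 1 - 8 / N with hr
  have hx : 8 / N ≤ 1 / 4 := by rw [div_le_iff₀ hN0]; linarith
  have hx0 : 0 < 8 / N := by positivity
  have hr0 : 0 < r := by linarith
  have hr1 : r ≤ 1 := by linarith
  set S := ∑' n, a n with hS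
  have hS0 : 0 ≤ S := tsum_nonneg ha0
  set m := ⌊N / 32⌋₊ with hm
  have hm1 : (m : ℝ) ≤ N / 32 := Nat.floor_le (by positivity)
  have hm2 : N / 32 ≤ (m : ℝ) + 1 := (Nat.lt_floor_add_one _).le
  -- `1 - x ≥ e^{-2x}` for `0 ≤ x ≤ 1/2`
  have hrexp : Real.exp (-(16 / N)) ≤ r := by
    have h1 : 1 + 16 / N ≤ Real.exp (16 / N) := by linarith [Real.add_one_le_exp (16 / N)]
    have h2 : 16 / N = 2 * (8 / N) := by ring
    rw [Real.exp_neg]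
    refine (inv_anti₀ (by positivity) h1).trans ?_
    rw [inv_le_iff_one_le_mul₀ (by positivity), h2, hr]
    nlinarith
  have hpow : Real.exp (-2) ≤ r ^ (2 * (m + k)) := by
    calc Real.exp (-2) ≤ Real.exp ((2 * (m + k) : ℕ) * (-(16 / N))) := by
          refine Real.exp_le_exp.2 ?_
          have h3 : (m : ℝ) + k ≤ N / 16 := by linarith
          have h4 : ((m : ℝ) + k) * (32 / N) ≤ N / 16 * (32 / N) := by gcongr
          have h5 : N / 16 * (32 / N) = 2 := by field_simp; norm_num
          push_cast
          have h6 : 2 * ((m : ℝ) + k) * -(16 / N) = -(((m : ℝ) + k) * (32 / N)) := by ring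
          rw [h6]
          linarith
      _ = Real.exp (-(16 / N)) ^ (2 * (m + k)) := by rw [Real.exp_nat_mul]
      _ ≤ _ := pow_le_pow_left₀ (Real.exp_pos _).le hrexp _
  have hsr : Summable fun n => a n * r ^ (2 * n) :=
    ha.of_nonneg_of_le (fun n => mul_nonneg (ha0 n) (pow_nonneg hr0.le _))
      fun n => mul_le_of_le_one_right (ha0 n) (pow_le_one₀ hr0.le hr1)
  have hhead : (∑ n ∈ Finset.range (m + k), a n) * Real.exp (-2) ≤ 2 * S * Real.exp (-4) := by
    calc (∑ n ∈ Finset.range (m + k), a n) * Real.exp (-2)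
        ≤ ∑ n ∈ Finset.range (m + k), a n * r ^ (2 * n) := by
          rw [Finset.sum_mul]
          refine Finset.sum_le_sum fun n hn => mul_le_mul_of_nonneg_left ?_ (ha0 n)
          refine hpow.trans (pow_le_pow_of_le_one hr0.le hr1 ?_)
          have := Finset.mem_range.1 hn
          omega
      _ ≤ ∑' n, a n * r ^ (2 * n) :=
          hsr.sum_le_tsum _ fun n _ => mul_nonneg (ha0 n) (pow_nonneg hr0.le _)
      _ ≤ _ := hdamp
  have hhalf : ∑ n ∈ Finset.range (m + k), a n ≤ S / 2 := by
    have e1 : Real.exp (-4) = Real.exp (-2) * Real.exp (-2) := by rw [← Real.exp_add]; norm_num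
    have e2 : Real.exp (-2) ≤ 1 / 4 := by
      rw [Real.exp_neg, inv_le_comm₀ (Real.exp_pos _) (by norm_num)]
      have : Real.exp 2 = Real.exp 1 * Real.exp 1 := by rw [← Real.exp_add]; norm_num
      rw [this]
      nlinarith [Real.exp_one_gt_d9]
    rw [e1, ← mul_assoc] at hhead
    have := le_of_mul_le_mul_right hhead (Real.exp_pos _)
    nlinarith
  have hsplit := ha.sum_add_tsum_nat_add (m + k)
  have h7 : 1 / ((m : ℝ) + 1) ^ (2 * k) ≤ (32 / N) ^ (2 * k) := by
    have : (32 : ℝ) / N = 1 / (N / 32) := by rw [one_div_div]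
    rw [this, div_pow, one_pow]
    gcongr
  linarith [htail m]

theorem unitBall_tail_le {k : ℕ} {f : ℂ → ℂ} (hf : f ∈ unitBall k) (m : ℕ) :
    ∑' n, ‖taylorCoeff f (n + (m + k))‖ ^ 2 ≤ 1 / ((m : ℝ) + 1) ^ (2 * k) := by
  obtain ⟨hs, hle⟩ := sum_pow_mul_taylorCoeff_le hf
  set b : ℕ → ℝ := fun n => ((n : ℝ) + 1) ^ (2 * k) * ‖taylorCoeff f (n + k)‖ ^ 2 with hb
  have hb0 : ∀ n, 0 ≤ b n := fun n => by positivity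
  have hsm : Summable fun n => b (n + m) := (summable_nat_add_iff m).2 hs
  have h1 : ∀ n,
      ((m : ℝ) + 1) ^ (2 * k) * ‖taylorCoeff f (n + (m + k))‖ ^ 2 ≤ b (n + m) := fun n => by
    simp only [hb, add_assoc]
    gcongr
    omega
  have h2 : ∑' n, b (n + m) ≤ 1 := by
    have := hs.sum_add_tsum_nat_add m
    have h3 := Finset.sum_nonneg fun n (_ : n ∈ Finset.range m) => hb0 n
    linarith
  rw [le_div_iff₀' (by positivity), ← tsum_mul_left]
  exact ((hsm.of_nonneg_of_le (fun n => by positivity) h1).tsum_le_tsum h1 hsm).trans h2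

/-- The stability estimate with an arbitrary positive upper bound `ε` of the norm on the arc, which
covers functions vanishing on the arc as well. -/
theorem norm2_le_of_normArc_le {k : ℕ} (hk : 1 ≤ k) {f : ℂ → ℂ} (hf : f ∈ unitBall k)
    {a lam ε : ℝ} (h0 : 0 < lam) (h1 : lam < 1) (hε : 0 < ε) (harc : normArc f a lam ≤ ε)
    (hN : 32 * k ≤ lam * Real.log (1 / ε)) :
    norm2 f ≤ (2 * 32 ^ k + 2 ^ k * k.factorial) / (lam * Real.log (1 / ε)) ^ k := by
  have hH : MemH2 f := by simpa using hf.1 0 (Nat.zero_le k)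
  have hk' : (1 : ℝ) ≤ k := by exact_mod_cast hk
  set L := Real.log (1 / ε) with hL
  set N := lam * L with hNdef
  have hN0 : 0 < N := by linarith
  have hL0 : 0 < L := pos_of_mul_pos_right hN0 h0.le
  have hNL : N ≤ L := mul_le_of_le_one_left hL0.le h1.le
  have hεL : ε = Real.exp (-L) := by rw [hL, one_div, Real.log_inv, neg_neg, Real.exp_log hε]
  have hε1 : ε < 1 := by rw [hεL, Real.exp_lt_one_iff]; linarith
  set s := norm2 f with hs
  have hs0 : 0 ≤ s := Real.sqrt_nonneg _
  have hssq : s ^ 2 = ∑' n, ‖taylorCoeff f n‖ ^ 2 := hH.norm2_sq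
  rw [le_div_iff₀ (by positivity)]
  rcases le_or_gt (s ^ 2) ε with hcase | hcase
  · -- `s ≤ √ε ≤ e^{-N/2}`
    have h2 : s ≤ Real.exp (-(N / 2)) := by
      refine le_of_sq_le_sq (hcase.trans ?_) (Real.exp_pos _).le
      rw [hεL, ← Real.exp_nat_mul]
      refine Real.exp_le_exp.2 ?_
      push_cast
      linarith
    have h3 := Real.pow_div_factorial_le_exp (N / 2) (by positivity) k
    rw [div_le_iff₀ (by positivity), div_pow, div_le_iff₀ (by positivity)] at h3
    have h4 : Real.exp (-(N / 2)) * Real.exp (N / 2) = 1 := by rw [← Real.exp_add]; simp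
    calc s * N ^ k ≤ Real.exp (-(N / 2)) * (Real.exp (N / 2) * k.factorial * 2 ^ k) := by gcongr
      _ = (Real.exp (-(N / 2)) * Real.exp (N / 2)) * (2 ^ k * k.factorial) := by ring
      _ = 2 ^ k * k.factorial := by rw [h4, one_mul]
      _ ≤ _ := by linarith [show (0 : ℝ) < 2 * 32 ^ k by positivity]
  · have hspos : 0 < s := by
      rcases hs0.eq_or_lt with h | h
      · rw [← h] at hcase; norm_num at hcase; linarith
      · exact h
    have hεs : ε ≤ s := by
      refine le_of_sq_le_sq ?_ hs0
      nlinarith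
    have hlog : L / 2 ≤ Real.log (s / ε) := by
      rw [Real.log_div hspos.ne' hε.ne']
      have h2 := Real.log_le_log hε hcase.le
      rw [Real.log_pow] at h2
      have h3 : Real.log ε = -L := by rw [hεL, Real.log_exp]
      push_cast at h2
      linarith
    have hsum := summable_norm_taylorCoeff hk hf
    -- rotate the arc so that it starts at angle `0`
    set c : ℕ → ℂ := fun n => taylorCoeff f n * exp (a * I) ^ n with hc
    have hcn : ∀ n, ‖c n‖ = ‖taylorCoeff f n‖ := fun n => by
      rw [hc, norm_mul, norm_pow, norm_exp_ofReal_mul_I, one_pow, mul_one]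
    have hcs : Summable fun n => ‖c n‖ := by simpa only [hcn] using hsum
    have hbv : ∀ θ : ℝ, ∑' n, c n * exp (θ * I) ^ n = boundaryValue f (θ + a) := fun θ => by
      rw [boundaryValue_eq_tsum hH.1 hsum]
      refine tsum_congr fun n => ?_
      rw [hc, mul_assoc, ← mul_pow, ← Complex.exp_add]
      congr 3
      push_cast
      ring
    have hpos : 0 < 2 * Real.pi * lam := by have := Real.pi_pos; positivity
    have harc' : ∫ θ in (0 : ℝ)..(2 * Real.pi * lam), ‖∑' n, c n * exp (θ * I) ^ n‖ ^ 2
        ≤ 2 * Real.pi * lam * ε ^ 2 := by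
      simp_rw [hbv]
      rw [intervalIntegral.integral_comp_add_right (fun θ => ‖boundaryValue f θ‖ ^ 2), zero_add,
        add_comm _ a]
      rw [normArc, Real.sqrt_le_left hε.le, inv_mul_le_iff₀ hpos] at harc
      exact harc
    have hx0 : 0 < 8 / N := by positivity
    have hx1 : 8 / N < 1 := by rw [div_lt_one hN0]; linarith
    have htwo := tsum_mul_pow_le_of_arc hcs h0 h1 hε hεs (s := s)
      (by simp_rw [hcn]; exact hssq.symm.le) harc' (r := 1 - 8 / N) (by linarith) (by linarith)
    simp_rw [hcn] at htwo
    have hexp : 4 ≤ 2 * Real.log (s / ε) * (lam * ((1 - (1 - 8 / N)) / (1 + (1 - 8 / N)))) := by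
      have h2 : 8 / N / 2 ≤ (1 - (1 - 8 / N)) / (1 + (1 - 8 / N)) := by
        rw [sub_sub_cancel]
        exact div_le_div_of_nonneg_left hx0.le (by linarith) (by linarith)
      calc (4 : ℝ) = 2 * (L / 2) * (lam * (8 / N / 2)) := by
            have : 2 * (L / 2) * (lam * (8 / N / 2)) = N * (8 / N) / 2 := by rw [hNdef]; ring
            rw [this, mul_div_cancel₀ _ hN0.ne']; norm_num
        _ ≤ _ := by
            have : 0 ≤ Real.log (s / ε) := by linarith
            gcongr
    have hdamp : ∑' n, ‖taylorCoeff f n‖ ^ 2 * (1 - 8 / N) ^ (2 * n)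
        ≤ 2 * (∑' n, ‖taylorCoeff f n‖ ^ 2) * Real.exp (-4) := by
      rw [← hssq]
      refine htwo.trans ?_
      gcongr
    have h5 := tsum_le_of_tail_of_damped (fun n => sq_nonneg _) hH.summable_sq_taylorCoeff hk
      (unitBall_tail_le hf) hN hdamp
    rw [← hssq] at h5
    have h6 : s ≤ 2 * (32 / N) ^ k := by
      refine le_of_sq_le_sq (h5.trans ?_) (by positivity)
      rw [mul_pow, ← pow_mul, mul_comm k 2]
      have : 0 ≤ (32 / N) ^ (2 * k) := by positivity
      linarith
    calc s * N ^ k ≤ 2 * (32 / N) ^ k * N ^ k := by gcongr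
      _ = 2 * 32 ^ k := by rw [div_pow]; field_simp
      _ ≤ _ := by linarith [show (0 : ℝ) < 2 ^ k * k.factorial by positivity]

end HardySobolev

theorem theorem1 (k : ℕ) (hk : 1 ≤ k) :
    ∃ α γ : ℝ, 0 < α ∧ 0 < γ ∧
      ∀ a lam : ℝ, 0 < lam → lam < 1 →
        ∀ f ∈ HardySobolev.unitBall k,
          HardySobolev.normArc f a lam ≤ Real.exp (-γ / lam) →
            HardySobolev.norm2 f ≤
              α / (lam * Real.log (1 / HardySobolev.normArc f a lam)) ^ k := by
  have hk' : (1 : ℝ) ≤ k := by exact_mod_cast hk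
  refine ⟨2 * 32 ^ k + 2 ^ k * k.factorial, 32 * k, by positivity, by positivity, ?_⟩
  intro a lam h0 h1 f hf harc
  have hlog : ∀ ε : ℝ, 0 < ε → ε ≤ Real.exp (-(32 * k) / lam) →
      32 * k ≤ lam * Real.log (1 / ε) := by
    intro ε hε hle
    have h2 := Real.log_le_log hε hle
    rw [Real.log_exp, le_div_iff₀ h0] at h2
    rw [one_div, Real.log_inv]
    linarith
  rcases (show 0 ≤ HardySobolev.normArc f a lam from Real.sqrt_nonneg _).eq_or_lt with hz | hpos
  · -- a function vanishing on the arc satisfies the bound for every small `ε`; let `ε → 0`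
    have hlim : Tendsto (fun ε : ℝ => (2 * 32 ^ k + 2 ^ k * (k.factorial : ℝ)) /
        (lam * Real.log (1 / ε)) ^ k) (𝓝[>] 0) (𝓝 0) := by
      have hinv : Tendsto (fun ε : ℝ => 1 / ε) (𝓝[>] 0) atTop := by
        simpa only [one_div] using tendsto_inv_nhdsGT_zero (𝕜 := ℝ)
      exact ((tendsto_pow_atTop (by omega)).comp
        ((Real.tendsto_log_atTop.comp hinv).const_mul_atTop h0)).const_div_atTop _
    have hle : HardySobolev.norm2 f ≤ 0 := by
      refine ge_of_tendsto hlim ?_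
      filter_upwards [Ioo_mem_nhdsGT (Real.exp_pos (-(32 * k) / lam))] with ε hε
      exact HardySobolev.norm2_le_of_normArc_le hk hf h0 h1 hε.1 (hz ▸ hε.1.le)
        (hlog ε hε.1 hε.2.le)
    refine hle.trans (div_nonneg (by positivity) ?_)
    -- here `log (1 / 0) = 0`, so the right side is `α / 0 ^ k = 0`
    rw [← hz]
    simp
  · exact HardySobolev.norm2_le_of_normArc_le hk hf h0 h1 hpos le_rfl (hlog _ hpos harc)
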